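/- Let $0<H<2/3$ and let $(B^H_t)_{t\ge 0}$ be a fractional Brownian motion with Hurst parameter $H$ on a probability space $(\Omega,\mathcal F,\mathcal P)$, that is, a centered Gaussian process with covariance $$\mathbf E(B^H_tB^H_s)=\tfrac12\big(s^{2H}+t^{2H}-|t-s|^{2H}\big),\qquad s,t\ge 0,$$ and almost surely continuous paths. For $\varepsilon>0$ let $f_\varepsilon(x)=\frac{1}{\sqrt{2\pi\varepsilon}}e^{-x^2/(2\varepsilon)}$ and, for $t\ge 0$, $$\alpha'_{t,\varepsilon}(0):=-\int_0^t\int_0^s f'_\varepsilon(B^H_s-B^H_r)\,(s-r)^{2H-1}\,dr\,ds .$$ Then $\alpha'_{t,\varepsilon}(0)\in L^2(\mathcal P)$ for all $t\ge 0$ and $\varepsilon>0$, and there is a process $(\alpha'_t(0))_{t\ge 0}$ in $L^2(\mathcal P)$ such that, for every $t\ge0$, $$\alpha'_{t,\varepsilon}(0)\to\alpha'_t(0)\quad\text{in } L^2(\mathcal P)\text{ as }\varepsilon\to 0^+ .$$ Moreover, $\alpha'_t(0)$ is continuous in $t$: the process can be chosen so that all its sample paths $t\mapsto\alpha'_t(0)(\omega)$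 are continuous on $[0,\infty)$, and $t\mapsto\alpha'_t(0)$ is continuous as a map from $[0,\infty)$ to $L^2(\mathcal P)$. -/

import Mathlib

open MeasureTheory ProbabilityTheory Filter Topology
open scoped NNReal ENNReal

noncomputable section

/-- `B = (B_t)_{t ≥ 0}` is a (standard) fractional Brownian motion with Hurst parameter `H` under
`P`: a centered Gaussian process with covariance
`E (B_t B_s) = (s ^ (2H) + t ^ (2H) - |t - s| ^ (2H)) / 2` and almost surely continuous paths. -/
structure IsFractionalBrownianMotion {Ω : Type*} [MeasurableSpace Ω]
    (H : ℝ) (B : ℝ≥0 → Ω → ℝ) (P : Measure Ω) : Prop where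
  isGaussianProcess : IsGaussianProcess B P
  integral_eq_zero : ∀ t : ℝ≥0, ∫ ω, B t ω ∂P = 0
  integral_mul_eq : ∀ s t : ℝ≥0, ∫ ω, B t ω * B s ω ∂P =
    (1 / 2) * ((s : ℝ) ^ (2 * H) + (t : ℝ) ^ (2 * H) - |(t : ℝ) - (s : ℝ)| ^ (2 * H))
  continuous_paths : ∀ᵐ ω ∂P, Continuous fun t : ℝ≥0 ↦ B t ω

/-- The centered Gaussian density `f_ε(x) = (2 π ε)^{-1/2} exp (- x² / (2 ε))` of variance `ε`. -/
def gaussKernel (ε x : ℝ) : ℝ :=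
  1 / Real.sqrt (2 * Real.pi * ε) * Real.exp (-(1 / 2) * x ^ 2 / ε)

/-- The approximation
`α'_{t,ε}(y) = - ∫_0^t ∫_0^s f_ε'(B_s - B_r - y) (s - r)^{2H-1} dr ds`
of the derivative of self-intersection local time of `B` at level `y`. -/
def dsltApprox {Ω : Type*} (H : ℝ) (B : ℝ≥0 → Ω → ℝ) (y ε : ℝ) (t : ℝ≥0) (ω : Ω) : ℝ :=
  -∫ s in (0 : ℝ)..t, ∫ r in (0 : ℝ)..s,
    deriv (gaussKernel ε) (B s.toNNReal ω - B r.toNNReal ω - y) * (s - r) ^ (2 * H - 1)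

end

/-! The proof is a second-moment computation. For increments X over [r, s] and Y over [r', s'] with
variances λ, ρ and covariance μ, Fourier inversion gives E f_ε'(X) f_η'(Y) = μ / (2π ((λ+ε)(ρ+η) -
μ²)^{3/2}) (`integral_deriv_gaussKernel_mul`). Letting ε, η vanish only lowers the denominator, so
the kernel at ε = η = 0 dominates all the others. Its integrability, with weights (s-r)^{2H-1} and
(s'-r')^{2H-1}, is the core of the matter.

The determinant λρ - μ² is bounded below by strong local nondeterminism
(`exists_pos_mul_le_incrDet`): an endpoint at distance at least d from the other three times
contributes a factor d^{2H}. For overlapping, nested and disjoint intervals this is combined with an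
upper bound on |μ|; the result is a constant times a product of three factors |·|^{-p}
(`exists_kernel_le_of_lt`). The three differences form a spanning tree on the times s, r, s', r' and
always include s - s'. The exponent is p = max (1/2 + 3H/4) (1 - H/4), and p < 1 is exactly where H
< 2/3 is needed. Integrating out r and r' costs constants, and s, s' in (a, b] leave C (b-a)^{2-p}
(`exists_lintegral_domKernel_le`).

Two conclusions follow. By dominated convergence the mixed moments of the approximations at ε and η
converge to one limit, so the approximations are Cauchy in L²
(`exists_tendsto_eLpNorm_dsltApprox_sub`). The increment over (a, b] has second moment at most C
(b-a)^{2-p} uniformly in ε, hence also in the limit. Since 2 - p > 1, dyadic chaining as in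
Kolmogorov's criterion gives a continuous modification
(`exists_continuous_modification_of_eLpNorm_le`). -/

/-! ### Spectral representation and strong local nondeterminism -/

theorem integrableOn_Ioi_zero_of_rpow_bounds {f : ℝ → ℝ} (hf : Measurable f) {A a b : ℝ}
    (ha : -1 < a) (hb : b < -1) (h₀ : ∀ x ∈ Set.Ioc (0 : ℝ) 1, |f x| ≤ A * x ^ a)
    (h₁ : ∀ x ∈ Set.Ioi (1 : ℝ), |f x| ≤ A * x ^ b) : IntegrableOn f (Set.Ioi 0) := by
  rw [← Set.Ioc_union_Ioi_eq_Ioi (zero_le_one' ℝ)]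
  refine IntegrableOn.union ?_ ?_
  · have h : IntegrableOn (fun x : ℝ ↦ A * x ^ a) (Set.Ioc 0 1) :=
      ((intervalIntegrable_iff_integrableOn_Ioc_of_le zero_le_one).1
        (intervalIntegral.intervalIntegrable_rpow' ha)).const_mul A
    refine Integrable.mono' h hf.aestronglyMeasurable ?_
    filter_upwards [ae_restrict_mem measurableSet_Ioc] with x hx using h₀ x hx
  · have h : IntegrableOn (fun x : ℝ ↦ A * x ^ b) (Set.Ioi 1) :=
      (integrableOn_Ioi_rpow_of_lt hb one_pos).const_mul A
    refine Integrable.mono' h hf.aestronglyMeasurable ?_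
    filter_upwards [ae_restrict_mem measurableSet_Ioi] with x hx using h₁ x hx

theorem abs_one_sub_cos_le_two (x : ℝ) : |1 - Real.cos x| ≤ 2 := by
  rw [abs_le]; constructor <;> linarith [Real.cos_le_one x, Real.neg_one_le_cos x]

theorem abs_one_sub_cos_le_sq (x : ℝ) : |1 - Real.cos x| ≤ x ^ 2 / 2 := by
  rw [abs_of_nonneg (by linarith [Real.cos_le_one x])]
  linarith [Real.one_sub_sq_div_two_le_cos (x := x)]

theorem integrableOn_one_sub_cos_mul_rpow {α : ℝ} (h₀ : 0 < α) (h₁ : α < 1) (t : ℝ) :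
    IntegrableOn (fun x : ℝ ↦ (1 - Real.cos (t * x)) * x ^ (-1 - 2 * α)) (Set.Ioi 0) := by
  refine integrableOn_Ioi_zero_of_rpow_bounds (A := 2 + t ^ 2) (a := 1 - 2 * α) (b := -1 - 2 * α)
    (by fun_prop) (by linarith) (by linarith) ?_ ?_
  · intro x hx
    have hx0 : 0 < x := hx.1
    rw [abs_mul, abs_of_pos (Real.rpow_pos_of_pos hx0 _)]
    have e : x ^ (1 - 2 * α) = x ^ 2 * x ^ (-1 - 2 * α) := by
      rw [← Real.rpow_natCast, ← Real.rpow_add hx0]; congr 1; push_cast; ring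
    rw [e, ← mul_assoc]
    gcongr
    refine (abs_one_sub_cos_le_sq _).trans ?_
    nlinarith [sq_nonneg x, sq_nonneg (t * x)]
  · intro x hx
    have hx0 : (0 : ℝ) < x := zero_lt_one.trans hx
    rw [abs_mul, abs_of_pos (Real.rpow_pos_of_pos hx0 _)]
    gcongr
    exact (abs_one_sub_cos_le_two _).trans (by nlinarith [sq_nonneg t])

/-- Scaling x by |t|. This is the spectral representation of |t|^{2α}; it is used with α = H for the
covariance and with α = 1/2 for the test function that isolates one time. -/
theorem integral_one_sub_cos_mul_rpow {α : ℝ} (h₀ : 0 < α) (t : ℝ) :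
    ∫ x in Set.Ioi (0 : ℝ), (1 - Real.cos (t * x)) * x ^ (-1 - 2 * α) =
      |t| ^ (2 * α) * ∫ x in Set.Ioi (0 : ℝ), (1 - Real.cos x) * x ^ (-1 - 2 * α) := by
  rcases eq_or_ne t 0 with rfl | ht
  · simp [Real.zero_rpow (by positivity : 2 * α ≠ 0)]
  have ht' : 0 < |t| := abs_pos.2 ht
  have h := integral_comp_mul_left_Ioi (fun x : ℝ ↦ (1 - Real.cos x) * x ^ (-1 - 2 * α)) 0 ht'
  rw [mul_zero] at h
  have e : ∀ x ∈ Set.Ioi (0 : ℝ), (1 - Real.cos (t * x)) * x ^ (-1 - 2 * α) =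
      |t| ^ (1 + 2 * α) * ((1 - Real.cos (|t| * x)) * (|t| * x) ^ (-1 - 2 * α)) := by
    intro x hx
    have hx0 : (0 : ℝ) < x := hx
    have hc : Real.cos (|t| * x) = Real.cos (t * x) := by
      rw [← Real.cos_abs (t * x), abs_mul, abs_of_pos hx0]
    rw [hc, Real.mul_rpow ht'.le hx0.le, show -1 - 2 * α = -(1 + 2 * α) by ring,
      Real.rpow_neg ht'.le]
    field_simp [(Real.rpow_pos_of_pos ht' (1 + 2 * α)).ne']
  rw [setIntegral_congr_fun measurableSet_Ioi e, integral_const_mul, h, smul_eq_mul, ← mul_assoc]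
  congr 1
  rw [Real.rpow_add ht', Real.rpow_one]
  field_simp

theorem integral_one_sub_cos_mul_rpow_pos {α : ℝ} (h₀ : 0 < α) (h₁ : α < 1) :
    0 < ∫ x in Set.Ioi (0 : ℝ), (1 - Real.cos x) * x ^ (-1 - 2 * α) := by
  have hint : IntegrableOn (fun x : ℝ ↦ (1 - Real.cos x) * x ^ (-1 - 2 * α)) (Set.Ioi 0) := by
    simpa using integrableOn_one_sub_cos_mul_rpow h₀ h₁ 1
  rw [setIntegral_pos_iff_support_of_nonneg_ae _ hint]
  · refine lt_of_lt_of_le ?_ (measure_mono (s := Set.Ioo (0 : ℝ) 1) ?_)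
    · simp
    · intro x hx
      refine ⟨?_, hx.1⟩
      have hc : Real.cos x < 1 := by
        have := Real.cos_lt_cos_of_nonneg_of_le_pi_div_two le_rfl
          (by linarith [hx.2, Real.pi_gt_three] : x ≤ Real.pi / 2) hx.1
        simpa using this
      exact (mul_pos (by linarith) (Real.rpow_pos_of_pos hx.1 _)).ne'
  · filter_upwards [ae_restrict_mem measurableSet_Ioi] with x hx
    exact mul_nonneg (by linarith [Real.cos_le_one x]) (Real.rpow_nonneg (le_of_lt hx) _)

theorem integrableOn_one_sub_cos_sq_mul_rpow {H : ℝ} (h₀ : 0 < H) (h₁ : H < 1) :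
    IntegrableOn (fun x : ℝ ↦ (1 - Real.cos x) ^ 2 * x ^ (2 * H - 3)) (Set.Ioi 0) := by
  refine integrableOn_Ioi_zero_of_rpow_bounds (A := 4) (a := 2 * H + 1) (b := 2 * H - 3)
    (by fun_prop) (by linarith) (by linarith) ?_ ?_
  · intro x hx
    have hx0 : 0 < x := hx.1
    rw [abs_mul, abs_of_pos (Real.rpow_pos_of_pos hx0 _)]
    have e : x ^ (2 * H + 1) = x ^ 4 * x ^ (2 * H - 3) := by
      rw [← Real.rpow_natCast, ← Real.rpow_add hx0]; congr 1; push_cast; ring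
    rw [e, ← mul_assoc, abs_pow]
    gcongr
    calc |1 - Real.cos x| ^ 2 ≤ (x ^ 2 / 2) ^ 2 := by gcongr; exact abs_one_sub_cos_le_sq x
      _ ≤ 4 * x ^ 4 := by nlinarith [sq_nonneg (x ^ 2)]
  · intro x hx
    have hx0 : (0 : ℝ) < x := zero_lt_one.trans hx
    rw [abs_mul, abs_of_pos (Real.rpow_pos_of_pos hx0 _), abs_pow]
    gcongr
    calc |1 - Real.cos x| ^ 2 ≤ 2 ^ 2 := by gcongr; exact abs_one_sub_cos_le_two x
      _ = 4 := by norm_num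

/-- The left side is |∑ u_i e^{i t_i x}|². Since the coefficients sum to zero, 1 can be subtracted
from each cosine in its expansion, and the terms become integrable against x^{-1-2H}. -/
theorem sum_mul_cos_sq_add_sum_mul_sin_sq {u : Fin 4 → ℝ} (t : Fin 4 → ℝ) (hu : ∑ i, u i = 0)
    (x : ℝ) :
    (∑ i, u i * Real.cos (t i * x)) ^ 2 + (∑ i, u i * Real.sin (t i * x)) ^ 2 =
      -∑ i, ∑ j, u i * u j * (1 - Real.cos ((t i - t j) * x)) := by
  have h : ∀ i j, u i * u j * (1 - Real.cos ((t i - t j) * x)) = u i * u j -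
      (u i * Real.cos (t i * x) * (u j * Real.cos (t j * x)) +
        u i * Real.sin (t i * x) * (u j * Real.sin (t j * x))) := by
    intro i j
    rw [sub_mul, Real.cos_sub]; ring
  simp_rw [h, Finset.sum_sub_distrib, Finset.sum_add_distrib, ← Finset.sum_mul_sum, hu]
  ring

/-- Strong local nondeterminism of fractional Brownian motion, for combinations of four values,
at unit scale. -/
theorem exists_pos_mul_sq_le_neg_sum_of_one_le {H : ℝ} (h₀ : 0 < H) (h₁ : H < 1) :
    ∃ k : ℝ, 0 < k ∧ ∀ u t : Fin 4 → ℝ, ∑ i, u i = 0 → (∀ i, i ≠ 0 → 1 ≤ |t i - t 0|) →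
      k * u 0 ^ 2 ≤ -∑ i, ∑ j, u i * u j * |t i - t j| ^ (2 * H) := by
  set K : ℝ := ∫ x in Set.Ioi (0 : ℝ), (1 - Real.cos x) * x ^ (-1 - 2 * H) with hK
  set K' : ℝ := ∫ x in Set.Ioi (0 : ℝ), (1 - Real.cos x) * x ^ (-1 - 2 * (1 / 2 : ℝ)) with hK'
  set F : ℝ := ∫ x in Set.Ioi (0 : ℝ), (1 - Real.cos x) ^ 2 * x ^ (2 * H - 3) with hF
  have hKpos : 0 < K := integral_one_sub_cos_mul_rpow_pos h₀ h₁
  have hKpos' : 0 < K' := integral_one_sub_cos_mul_rpow_pos (by norm_num) (by norm_num)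
  have hF0 : 0 ≤ F := setIntegral_nonneg measurableSet_Ioi fun x hx ↦
    mul_nonneg (sq_nonneg _) (Real.rpow_nonneg (le_of_lt hx) _)
  refine ⟨K' ^ 2 / ((F + 1) * K), by positivity, fun u t hu ht ↦ ?_⟩
  set τ : Fin 4 → ℝ := fun i ↦ t i - t 0 with hτ
  set Q : ℝ := -∑ i, ∑ j, u i * u j * |t i - t j| ^ (2 * H) with hQ
  have hint : ∀ i j, IntegrableOn
      (fun x : ℝ ↦ u i * u j * ((1 - Real.cos ((τ i - τ j) * x)) * x ^ (-1 - 2 * H)))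
      (Set.Ioi 0) := fun i j ↦ (integrableOn_one_sub_cos_mul_rpow h₀ h₁ _).const_mul _
  have e1 : ∀ x : ℝ, ((∑ i, u i * Real.cos (τ i * x)) ^ 2 + (∑ i, u i * Real.sin (τ i * x)) ^ 2)
      * x ^ (-1 - 2 * H) =
      -∑ i, ∑ j, u i * u j * ((1 - Real.cos ((τ i - τ j) * x)) * x ^ (-1 - 2 * H)) := by
    intro x
    rw [sum_mul_cos_sq_add_sum_mul_sin_sq τ hu]
    simp_rw [← mul_assoc, ← Finset.sum_mul]
    ring
  have hint1 : IntegrableOn (fun x : ℝ ↦ ((∑ i, u i * Real.cos (τ i * x)) ^ 2 +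
      (∑ i, u i * Real.sin (τ i * x)) ^ 2) * x ^ (-1 - 2 * H)) (Set.Ioi 0) := by
    simp_rw [e1]
    exact (integrable_finsetSum _ fun i _ ↦ integrable_finsetSum _ fun j _ ↦ hint i j).neg
  have hval1 : ∫ x in Set.Ioi (0 : ℝ), ((∑ i, u i * Real.cos (τ i * x)) ^ 2 +
      (∑ i, u i * Real.sin (τ i * x)) ^ 2) * x ^ (-1 - 2 * H) = K * Q := by
    simp_rw [e1]
    rw [integral_neg, integral_finsetSum _ fun i _ ↦ integrable_finsetSum _ fun j _ ↦ hint i j,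
      hQ, mul_neg, Finset.mul_sum]
    congr 1
    refine Finset.sum_congr rfl fun i _ ↦ ?_
    rw [integral_finsetSum _ fun j _ ↦ hint i j, Finset.mul_sum]
    refine Finset.sum_congr rfl fun j _ ↦ ?_
    rw [integral_const_mul, integral_one_sub_cos_mul_rpow h₀,
      show τ i - τ j = t i - t j by simp only [hτ]; ring]
    ring
  have hE : ∀ r : ℝ, IntegrableOn (fun x : ℝ ↦ (1 - Real.cos (r * x)) *
      x ^ (-1 - 2 * (1 / 2 : ℝ))) (Set.Ioi 0) :=
    integrableOn_one_sub_cos_mul_rpow (by norm_num) (by norm_num)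
  -- The function (1 - cos x) / x² is the Fourier transform, up to a constant, of the tent on [-1,
  -- 1]. Product-to-sum formulas exhibit the tent as a second difference of |τ|.
  have e2 : ∀ x : ℝ, (1 - Real.cos x) * x ^ (-1 - 2 * (1 / 2 : ℝ)) * ∑ i, u i * Real.cos (τ i * x)
      = ∑ i, u i * (1 / 2 * ((1 - Real.cos ((τ i + 1) * x)) * x ^ (-1 - 2 * (1 / 2 : ℝ))) +
        1 / 2 * ((1 - Real.cos ((τ i - 1) * x)) * x ^ (-1 - 2 * (1 / 2 : ℝ))) -
        (1 - Real.cos (τ i * x)) * x ^ (-1 - 2 * (1 / 2 : ℝ))) := by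
    intro x
    rw [Finset.mul_sum]
    refine Finset.sum_congr rfl fun i _ ↦ ?_
    rw [show (τ i + 1) * x = τ i * x + x by ring, show (τ i - 1) * x = τ i * x - x by ring,
      Real.cos_add, Real.cos_sub]
    ring
  have hint2' : ∀ i, IntegrableOn (fun x : ℝ ↦
      1 / 2 * ((1 - Real.cos ((τ i + 1) * x)) * x ^ (-1 - 2 * (1 / 2 : ℝ))) +
        1 / 2 * ((1 - Real.cos ((τ i - 1) * x)) * x ^ (-1 - 2 * (1 / 2 : ℝ))) -
        (1 - Real.cos (τ i * x)) * x ^ (-1 - 2 * (1 / 2 : ℝ))) (Set.Ioi 0) := fun i ↦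
    (((hE _).const_mul _).add ((hE _).const_mul _)).sub (hE _)
  have hint2 : IntegrableOn (fun x : ℝ ↦ (1 - Real.cos x) * x ^ (-1 - 2 * (1 / 2 : ℝ)) *
      ∑ i, u i * Real.cos (τ i * x)) (Set.Ioi 0) := by
    simp_rw [e2]
    exact integrable_finsetSum _ fun i _ ↦ (hint2' i).const_mul _
  have hval2 : ∫ x in Set.Ioi (0 : ℝ), (1 - Real.cos x) * x ^ (-1 - 2 * (1 / 2 : ℝ)) *
      ∑ i, u i * Real.cos (τ i * x) = K' * u 0 := by
    simp_rw [e2]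
    rw [integral_finsetSum _ fun i _ ↦ (hint2' i).const_mul _]
    have hi : ∀ i, ∫ x in Set.Ioi (0 : ℝ), u i *
        (1 / 2 * ((1 - Real.cos ((τ i + 1) * x)) * x ^ (-1 - 2 * (1 / 2 : ℝ))) +
        1 / 2 * ((1 - Real.cos ((τ i - 1) * x)) * x ^ (-1 - 2 * (1 / 2 : ℝ))) -
        (1 - Real.cos (τ i * x)) * x ^ (-1 - 2 * (1 / 2 : ℝ))) =
        u i * (K' * (1 / 2 * |τ i + 1| + 1 / 2 * |τ i - 1| - |τ i|)) := by
      intro i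
      have hadd : IntegrableOn (fun x : ℝ ↦
          1 / 2 * ((1 - Real.cos ((τ i + 1) * x)) * x ^ (-1 - 2 * (1 / 2 : ℝ))) +
          1 / 2 * ((1 - Real.cos ((τ i - 1) * x)) * x ^ (-1 - 2 * (1 / 2 : ℝ)))) (Set.Ioi 0) :=
        ((hE _).const_mul _).add ((hE _).const_mul _)
      rw [integral_const_mul, integral_sub hadd (hE _),
        integral_add ((hE _).const_mul _) ((hE _).const_mul _), integral_const_mul,
        integral_const_mul]
      simp only [integral_one_sub_cos_mul_rpow (by norm_num : (0 : ℝ) < 1 / 2), ← hK']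
      rw [show 2 * (1 / 2 : ℝ) = 1 by norm_num]
      simp only [Real.rpow_one]
      ring
    simp_rw [hi]
    rw [Finset.sum_eq_single 0]
    · simp [hτ]; ring
    · intro i _ hi0
      have h := ht i hi0
      -- The tent vanishes at |τ i| ≥ 1, so only the coefficient of the isolated time survives.
      have : 1 / 2 * |τ i + 1| + 1 / 2 * |τ i - 1| - |τ i| = 0 := by
        change 1 ≤ |τ i| at h
        rcases le_abs.1 h with h | h
        · rw [abs_of_nonneg (by linarith), abs_of_nonneg (by linarith),
            abs_of_nonneg (by linarith)]; ring
        · rw [abs_of_nonpos (by linarith), abs_of_nonpos (by linarith),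
            abs_of_nonpos (by linarith)]; ring
      rw [this]; ring
    · simp
  -- Cauchy–Schwarz in the form 2θ⟨g, h⟩ ≤ |g|² + θ²|h|², with the tent's transform divided by the
  -- square root of the spectral density as h.
  have hθ : ∀ θ : ℝ, 2 * θ * (K' * u 0) ≤ K * Q + θ ^ 2 * F := by
    intro θ
    rw [← hval2, ← hval1, ← integral_const_mul, hF, ← integral_const_mul,
      ← integral_add hint1 ((integrableOn_one_sub_cos_sq_mul_rpow h₀ h₁).const_mul _)]
    refine setIntegral_mono_on (hint2.const_mul _)
      (hint1.add ((integrableOn_one_sub_cos_sq_mul_rpow h₀ h₁).const_mul _)) measurableSet_Ioi ?_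
    intro x hx
    have hx0 : (0 : ℝ) < x := hx
    set g := ∑ i, u i * Real.cos (τ i * x)
    set s := ∑ i, u i * Real.sin (τ i * x)
    set c := 1 - Real.cos x
    set y := x ^ (-(1 + 2 * H) / 2)
    set z := x ^ ((2 * H - 3) / 2)
    have h1 : x ^ (-1 - 2 * H) = y * y := by rw [← Real.rpow_add hx0]; congr 1; ring
    have h2 : x ^ (2 * H - 3) = z * z := by rw [← Real.rpow_add hx0]; congr 1; ring
    have h3 : x ^ (-1 - 2 * (1 / 2 : ℝ)) = y * z := by rw [← Real.rpow_add hx0]; congr 1; ring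
    rw [h1, h2, h3]
    nlinarith [sq_nonneg (g * y - θ * c * z), sq_nonneg (s * y)]
  -- The optimal θ has F in the denominator; F + 1 replaces it because only F ≥ 0 has been
  -- established.
  have h := hθ (K' * u 0 / (F + 1))
  have hF1 : 0 < F + 1 := by linarith
  rw [div_mul_eq_mul_div, div_le_iff₀ (by positivity)]
  have h2 : 2 * (K' * u 0 / (F + 1)) * (K' * u 0) * (F + 1) ≤
      (K * Q + (K' * u 0 / (F + 1)) ^ 2 * F) * (F + 1) := by gcongr
  have e3 : 2 * (K' * u 0 / (F + 1)) * (K' * u 0) * (F + 1) = 2 * (K' * u 0) ^ 2 := by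
    field_simp
  have e4 : (K' * u 0 / (F + 1)) ^ 2 * F * (F + 1) = (K' * u 0) ^ 2 * (F / (F + 1)) := by
    field_simp
  have h5 : F / (F + 1) ≤ 1 := by rw [div_le_one hF1]; linarith
  nlinarith [mul_le_mul_of_nonneg_left h5 (sq_nonneg (K' * u 0))]

theorem exists_pos_mul_sq_le_neg_sum {H : ℝ} (h₀ : 0 < H) (h₁ : H < 1) :
    ∃ k : ℝ, 0 < k ∧ ∀ (u t : Fin 4 → ℝ) (d : ℝ), 0 < d → ∑ i, u i = 0 →
      (∀ i, i ≠ 0 → d ≤ |t i - t 0|) →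
      k * d ^ (2 * H) * u 0 ^ 2 ≤ -∑ i, ∑ j, u i * u j * |t i - t j| ^ (2 * H) := by
  obtain ⟨k, hk, h⟩ := exists_pos_mul_sq_le_neg_sum_of_one_le h₀ h₁
  refine ⟨k, hk, fun u t d hd hu ht ↦ ?_⟩
  have h' := h u (fun i ↦ t i / d) hu fun i hi ↦ by
    rw [← sub_div, abs_div, abs_of_pos hd, le_div_iff₀ hd, one_mul]; exact ht i hi
  have e : ∀ i j, |t i - t j| ^ (2 * H) = d ^ (2 * H) * |t i / d - t j / d| ^ (2 * H) := by
    intro i j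
    rw [← Real.mul_rpow hd.le (abs_nonneg _), ← sub_div, abs_div, abs_of_pos hd]
    congr 1; field_simp
  have e2 : -∑ i, ∑ j, u i * u j * |t i - t j| ^ (2 * H) =
      d ^ (2 * H) * -∑ i, ∑ j, u i * u j * |t i / d - t j / d| ^ (2 * H) := by
    simp_rw [e, mul_neg, Finset.mul_sum]
    congr 1
    refine Finset.sum_congr rfl fun i _ ↦ Finset.sum_congr rfl fun j _ ↦ by ring
  rw [e2, mul_comm k, mul_assoc]
  gcongr

/-! ### Covariance and determinant of two increments -/

/-- The covariance of the increments of fractional Brownian motion over `[r, s]` and `[r', s']`. -/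
noncomputable def incrCov (H s r s' r' : ℝ) : ℝ :=
  1 / 2 * (|s - r'| ^ (2 * H) + |r - s'| ^ (2 * H) - |s - s'| ^ (2 * H) - |r - r'| ^ (2 * H))

/-- The determinant of the covariance matrix of the increments over `[r, s]` and `[r', s']`. -/
noncomputable def incrDet (H s r s' r' : ℝ) : ℝ :=
  |s - r| ^ (2 * H) * |s' - r'| ^ (2 * H) - incrCov H s r s' r' ^ 2

theorem incrCov_swap (H s r s' r' : ℝ) : incrCov H s' r' s r = incrCov H s r s' r' := by
  simp only [incrCov, abs_sub_comm s' r, abs_sub_comm r' s, abs_sub_comm s' s, abs_sub_comm r' r]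
  ring

theorem incrDet_swap (H s r s' r' : ℝ) : incrDet H s' r' s r = incrDet H s r s' r' := by
  simp only [incrDet, incrCov_swap H s r s' r']; ring

theorem incrCov_flip (H s r s' r' : ℝ) : incrCov H r s s' r' = -incrCov H s r s' r' := by
  simp only [incrCov]; ring

theorem incrDet_flip (H s r s' r' : ℝ) : incrDet H r s s' r' = incrDet H s r s' r' := by
  simp only [incrDet, incrCov_flip H s r s' r', abs_sub_comm r s]; ring

/-- The determinant is ρ times the residual variance of X after linear regression on Y.
Nondeterminism bounds that residual below, with the time s singled out; the swap and flip symmetries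
of `incrDet` let any other endpoint play its role. -/
theorem exists_pos_mul_le_incrDet {H : ℝ} (h₀ : 0 < H) (h₁ : H < 1) :
    ∃ k : ℝ, 0 < k ∧ ∀ s r s' r' d : ℝ, 0 < d → d ≤ |s - r| → d ≤ |s - s'| → d ≤ |s - r'| →
      s' ≠ r' → k * d ^ (2 * H) * |s' - r'| ^ (2 * H) ≤ incrDet H s r s' r' := by
  obtain ⟨k, hk, h⟩ := exists_pos_mul_sq_le_neg_sum h₀ h₁
  refine ⟨k / 2, by positivity, fun s r s' r' d hd h1 h2 h3 hne ↦ ?_⟩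
  set lam := |s - r| ^ (2 * H) with hlam
  set rho := |s' - r'| ^ (2 * H) with hrho
  set m := incrCov H s r s' r' with hm
  have hrho0 : 0 < rho := Real.rpow_pos_of_pos (abs_pos.2 (sub_ne_zero.2 hne)) _
  have h2H : 2 * H ≠ 0 := by positivity
  -- These are the coefficients of X - (μ/ρ) Y, the regression residual. The quadratic form equals
  -- twice its variance, whence the factor `k / 2`.
  have key := h ![1, -1, -(m / rho), m / rho] ![s, r, s', r'] d hd (by simp [Fin.sum_univ_four])
    (by
      intro i hi
      fin_cases i
      · exact absurd rfl hi
      · simpa [abs_sub_comm] using h1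
      · simpa [abs_sub_comm] using h2
      · simpa [abs_sub_comm] using h3)
  have e : -∑ i, ∑ j, ![1, -1, -(m / rho), m / rho] i * ![1, -1, -(m / rho), m / rho] j *
      |![s, r, s', r'] i - ![s, r, s', r'] j| ^ (2 * H) =
      2 * (lam - 2 * (m / rho) * m + (m / rho) ^ 2 * rho) := by
    simp only [Fin.sum_univ_four, Matrix.cons_val_zero, Matrix.cons_val_one, Matrix.cons_val_two,
      Matrix.cons_val_three, Matrix.tail_cons, Matrix.head_cons, sub_self, abs_zero,
      Real.zero_rpow h2H, abs_sub_comm r s, abs_sub_comm s' s, abs_sub_comm r' s,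
      abs_sub_comm s' r, abs_sub_comm r' r, abs_sub_comm r' s']
    rw [← hlam, ← hrho]
    have : m = 1 / 2 * (|s - r'| ^ (2 * H) + |r - s'| ^ (2 * H) - |s - s'| ^ (2 * H) -
      |r - r'| ^ (2 * H)) := rfl
    generalize m / rho = q
    rw [this]
    ring
  rw [e] at key
  have e2 : (lam - 2 * (m / rho) * m + (m / rho) ^ 2 * rho) * rho = lam * rho - m ^ 2 := by
    field_simp; ring
  have h5 : k / 2 * d ^ (2 * H) ≤ lam - 2 * (m / rho) * m + (m / rho) ^ 2 * rho := by
    simp only [Matrix.cons_val_zero] at key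
    linarith
  calc k / 2 * d ^ (2 * H) * rho ≤ (lam - 2 * (m / rho) * m + (m / rho) ^ 2 * rho) * rho := by
        gcongr
    _ = _ := e2

/-! ### Upper bounds on the covariance and the exponent bookkeeping -/

/-- For 2H ≤ 1 this is subadditivity of the power, for 2H ≥ 1 Bernoulli's inequality. With δ > 0 it
improves on the Cauchy–Schwarz bound b^H L^H for an interval of length b nested in one of length L.
-/
theorem add_rpow_sub_rpow_le {H δ b c L : ℝ} (hH : H < 1) (hδ : 0 ≤ δ) (hδH : δ ≤ H)
    (hδH' : δ ≤ 1 - H) (hb : 0 < b) (hc : 0 < c) (hL : b + c ≤ L) :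
    (b + c) ^ (2 * H) - c ^ (2 * H) ≤ 2 * (b ^ (H + δ) * L ^ (H - δ)) := by
  have hL0 : 0 < L := by linarith
  have hbL : b ≤ L := by linarith
  have hpos : 0 ≤ b ^ (H + δ) * L ^ (H - δ) := by positivity
  rcases le_total (2 * H) 1 with h | h
  · have h1 := Real.rpow_add_le_add_rpow hb.le hc.le (by linarith : 0 ≤ 2 * H) h
    have h2 : b ^ (2 * H) ≤ b ^ (H + δ) * L ^ (H - δ) := by
      calc b ^ (2 * H) = b ^ (H + δ) * b ^ (H - δ) := by rw [← Real.rpow_add hb]; congr 1; ring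
        _ ≤ _ := by gcongr
    linarith
  · have hbc : 0 < b + c := by linarith
    have h1 := one_add_mul_self_le_rpow_one_add (s := -(b / (b + c)))
      (by rw [neg_le_neg_iff, div_le_one hbc]; linarith) h
    have e : 1 + -(b / (b + c)) = c / (b + c) := by field_simp; ring
    rw [e, Real.div_rpow hc.le hbc.le, le_div_iff₀ (by positivity)] at h1
    have e2 : (b + c) ^ (2 * H) = (b + c) * (b + c) ^ (2 * H - 1) := by
      rw [← Real.rpow_one_add' hbc.le (by linarith)]; congr 1; ring
    have e3 : (1 + 2 * H * -(b / (b + c))) * (b + c) ^ (2 * H) =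
        (b + c) ^ (2 * H) - 2 * H * (b * (b + c) ^ (2 * H - 1)) := by
      rw [e2]; field_simp
      ring
    have h2 : b * (b + c) ^ (2 * H - 1) ≤ b ^ (H + δ) * L ^ (H - δ) := by
      calc b * (b + c) ^ (2 * H - 1) ≤ b * L ^ (2 * H - 1) := by gcongr
        _ = b ^ (H + δ) * b ^ (1 - H - δ) * L ^ (2 * H - 1) := by
            rw [← Real.rpow_add hb, show H + δ + (1 - H - δ) = 1 by ring, Real.rpow_one]
        _ ≤ b ^ (H + δ) * L ^ (1 - H - δ) * L ^ (2 * H - 1) := by gcongr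
        _ = _ := by rw [mul_assoc, ← Real.rpow_add hL0]; ring_nf
    have h3 : 0 < b * (b + c) ^ (2 * H - 1) := by positivity
    nlinarith

/-- Two applications of the mean value inequality on [g, ∞), where the second derivative of z^{2H}
is at most 2 g^{2H-2} in absolute value. It captures the decay of the covariance of two intervals
separated by a gap g. -/
theorem abs_rpow_second_difference_le {H x y g : ℝ} (h₀ : 0 < H) (h₁ : H < 1) (hx : 0 < x)
    (hy : 0 < y) (hg : 0 < g) :
    |(x + g + y) ^ (2 * H) + g ^ (2 * H) - (x + g) ^ (2 * H) - (g + y) ^ (2 * H)| ≤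
      2 * (x * y * g ^ (2 * H - 2)) := by
  have h1 : ∀ z, g ≤ z → |(z + x) ^ (2 * H - 1) - z ^ (2 * H - 1)| ≤ g ^ (2 * H - 2) * x := by
    intro z hz
    have := Convex.norm_image_sub_le_of_norm_hasDerivWithin_le (𝕜 := ℝ) (s := Set.Ici g)
      (f := fun z : ℝ ↦ z ^ (2 * H - 1)) (f' := fun z : ℝ ↦ (2 * H - 1) * z ^ (2 * H - 1 - 1))
      (C := g ^ (2 * H - 2)) (x := z) (y := z + x) ?_ ?_ (convex_Ici g) hz
      (by simp only [Set.mem_Ici]; linarith)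
    · simpa [Real.norm_eq_abs, abs_of_pos hx] using this
    · intro t ht
      have ht0 : 0 < t := lt_of_lt_of_le hg ht
      exact (Real.hasDerivAt_rpow_const (Or.inl ht0.ne')).hasDerivWithinAt
    · intro t ht
      have ht0 : 0 < t := lt_of_lt_of_le hg ht
      rw [Real.norm_eq_abs, abs_mul, abs_of_pos (Real.rpow_pos_of_pos ht0 _),
        show 2 * H - 1 - 1 = 2 * H - 2 by ring]
      have ha : |2 * H - 1| ≤ 1 := by rw [abs_le]; constructor <;> linarith
      calc |2 * H - 1| * t ^ (2 * H - 2) ≤ 1 * g ^ (2 * H - 2) :=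
            mul_le_mul ha (Real.rpow_le_rpow_of_nonpos hg ht (by linarith)) (by positivity)
              zero_le_one
        _ = _ := one_mul _
  have h2 := Convex.norm_image_sub_le_of_norm_hasDerivWithin_le (𝕜 := ℝ) (s := Set.Ici g)
      (f := fun z : ℝ ↦ (z + x) ^ (2 * H) - z ^ (2 * H))
      (f' := fun z : ℝ ↦ 1 * (2 * H) * (z + x) ^ (2 * H - 1) - (2 * H) * z ^ (2 * H - 1))
      (C := 2 * (g ^ (2 * H - 2) * x)) (x := g) (y := g + y) ?_ ?_ (convex_Ici g)
      (by simp) (by simp only [Set.mem_Ici]; linarith)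
  · rw [Real.norm_eq_abs, Real.norm_eq_abs, show g + y - g = y by ring, abs_of_pos hy] at h2
    calc _ = |(g + y + x) ^ (2 * H) - (g + y) ^ (2 * H) - ((g + x) ^ (2 * H) - g ^ (2 * H))| := by
          congr 1
          rw [show x + g + y = g + y + x by ring, add_comm x g]; ring
      _ ≤ _ := h2
      _ = _ := by ring
  · intro t ht
    have ht0 : 0 < t := lt_of_lt_of_le hg ht
    refine ((((hasDerivAt_id t).add_const x).rpow_const (Or.inl ?_)).sub
      (Real.hasDerivAt_rpow_const (Or.inl ht0.ne'))).hasDerivWithinAt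
    simp only [id]; positivity
  · intro t ht
    have := h1 t ht
    rw [Real.norm_eq_abs, one_mul, ← mul_sub, abs_mul, abs_of_pos (by positivity)]
    gcongr
    linarith

/-- Taking logarithms makes every kernel estimate a linear inequality, so that each configuration of
intervals reduces to choosing nonnegative multipliers. -/
theorem rpow_mul_div_le_of_log_le {H p x y m D C a b c : ℝ} (hx : 0 < x) (hy : 0 < y) (hm : 0 < m)
    (hD : 0 < D) (hC : 0 < C) (ha : 0 < a) (hb : 0 < b) (hc : 0 < c)
    (h : (2 * H - 1) * (Real.log x + Real.log y) + Real.log m - 3 / 2 * Real.log D ≤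
      Real.log C - p * (Real.log a + Real.log b + Real.log c)) :
    x ^ (2 * H - 1) * y ^ (2 * H - 1) * m / D ^ (3 / 2 : ℝ) ≤
      C * (a ^ (-p) * b ^ (-p) * c ^ (-p)) := by
  rw [← Real.log_le_log_iff (by positivity) (by positivity), Real.log_div (by positivity)
    (by positivity), Real.log_mul (by positivity) (by positivity), Real.log_mul (by positivity)
    (by positivity), Real.log_mul (by positivity) (by positivity), Real.log_mul (by positivity)
    (by positivity), Real.log_mul (by positivity) (by positivity), Real.log_rpow hx,
    Real.log_rpow hy, Real.log_rpow hD, Real.log_rpow ha, Real.log_rpow hb, Real.log_rpow hc]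
  linarith

theorem log_add_mul_log_add_mul_log_le {H k d R D : ℝ} (hk : 0 < k) (hd : 0 < d) (hR : 0 < R)
    (h : k * d ^ (2 * H) * R ^ (2 * H) ≤ D) :
    Real.log k + 2 * H * (Real.log d + Real.log R) ≤ Real.log D := by
  have := Real.log_le_log (by positivity) h
  rw [Real.log_mul (by positivity) (by positivity), Real.log_mul (by positivity) (by positivity),
    Real.log_rpow hd, Real.log_rpow hR] at this
  linarith

/-- The log-linear estimate behind the kernel bound for overlapping intervals. -/
theorem kernel_log_overlap {H p la lb lc lT lk lL lR lm lD : ℝ}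
    (hp1 : p < 1) (hp : 1 / 2 + 3 / 4 * H ≤ p) (hp' : 1 - H / 4 ≤ p) (hT : 0 ≤ lT)
    (ha : la ≤ lT) (hb : lb ≤ lT) (hc : lc ≤ lT) (hRa : la ≤ lR) (hRb : lb ≤ lR) (hLb : lb ≤ lL)
    (hLc : lc ≤ lL) (hD1 : lk + 2 * H * (lc + lR) ≤ lD) (hD2 : lk + 2 * H * (la + lL) ≤ lD)
    (hm : lm ≤ H * (lL + lR)) :
    (2 * H - 1) * (lL + lR) + lm - 3 / 2 * lD ≤ -(3 / 2) * lk + lT - p * (la + lb + lc) := by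
  have i1 := mul_nonneg (by linarith : 0 ≤ 1 - 3 / 2 * H) (sub_nonneg.2 hRa)
  have i2 := mul_nonneg (by linarith : 0 ≤ 1 - 3 / 2 * H) (sub_nonneg.2 hRb)
  have i3 := mul_nonneg (by linarith : 0 ≤ 1 - 3 / 2 * H) (sub_nonneg.2 hLb)
  have i4 := mul_nonneg (by linarith : 0 ≤ 1 - 3 / 2 * H) (sub_nonneg.2 hLc)
  have j1 := mul_nonneg (by linarith : 0 ≤ p - (1 / 2 + 3 / 4 * H)) (sub_nonneg.2 ha)
  have j2 := mul_nonneg (by linarith : 0 ≤ p - (1 - 3 / 2 * H)) (sub_nonneg.2 hb)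
  have j3 := mul_nonneg (by linarith : 0 ≤ p - (1 / 2 + 3 / 4 * H)) (sub_nonneg.2 hc)
  have j4 := mul_nonneg (by linarith : 0 ≤ 3 - 3 * p) hT
  linarith

/-- Cauchy–Schwarz alone would leave exponent -1 on both lengths, just failing to be integrable.
Interpolating with the decay across the gap improves this to -(1 - H/4), at the price of exponent
-H/2 on the gap. -/
theorem kernel_log_disjoint {H p lx ly lg lz lc lT lk lm lD : ℝ} (h₁ : H < 2 / 3)
    (hp1 : p < 1) (hp' : 1 - H / 4 ≤ p) (hT : 0 ≤ lT) (hx : lx ≤ lT) (hy : ly ≤ lT) (hg : lg ≤ lT)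
    (hc : lc ≤ Real.log 2 + lg ∧ lz = lx ∨ lc ≤ Real.log 2 + lx ∧ lz = lg)
    (hD : lk + 2 * H * (ly + lx) ≤ lD) (hm : lm ≤ H * (lx + ly))
    (hm' : lm ≤ lx + ly + (2 * H - 2) * lg) :
    (2 * H - 1) * (lx + ly) + lm - 3 / 2 * lD ≤
      -(3 / 2) * lk + Real.log 2 + lT - p * (lz + ly + lc) := by
  have hH : 0 < 1 - H := by linarith
  have h2 : 0 < Real.log 2 := Real.log_pos (by norm_num)
  -- The weights 1 - 5H/4 and H/4 on the two bounds sum to 1 - H, which is then cancelled.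
  have e : (1 - H) * lm ≤ (1 - H) * ((H + H / 4) * (lx + ly) - H / 2 * lg) := by
    have i1 := mul_le_mul_of_nonneg_left hm (by linarith : 0 ≤ (1 - H) - H / 4)
    have i2 := mul_le_mul_of_nonneg_left hm' (by linarith : 0 ≤ H / 4)
    linarith
  have e' := le_of_mul_le_mul_left e hH
  have j1 := mul_nonneg (by linarith : 0 ≤ p - (1 - H / 4)) (sub_nonneg.2 hx)
  have j2 := mul_nonneg (by linarith : 0 ≤ p - (1 - H / 4)) (sub_nonneg.2 hy)
  have j3 := mul_nonneg (by linarith : 0 ≤ p - H / 2) (sub_nonneg.2 hg)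
  have j4 := mul_nonneg (by linarith : 0 ≤ 3 - 3 * p) hT
  have j5 := mul_nonneg (by linarith : 0 ≤ 1 - p) h2.le
  rcases hc with ⟨hc, rfl⟩ | ⟨hc, rfl⟩
  all_goals
    have j6 := mul_nonneg (by linarith : 0 ≤ p) (sub_nonneg.2 hc)
    linarith

/-- Here b is the inner length, a and c are the outer gaps, and M is the larger gap. Cauchy–Schwarz
would again leave exponent -1 on b when M is comparable to L, so `hm` carries a gain of H/4. When b
dominates instead, part of its negative power is moved to M, and M is shared equally between a and
c; this yields the exponent 1/2 + 3H/4. -/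
theorem kernel_log_nested {H p la lb lc lT lk lL lm lD lM : ℝ} (h₀ : 0 < H)
    (hp1 : p < 1) (hp : 1 / 2 + 3 / 4 * H ≤ p) (hp' : 1 - H / 4 ≤ p) (hT : 0 ≤ lT)
    (ha : la ≤ lT) (hb : lb ≤ lT) (hc : lc ≤ lT) (hMa : la ≤ lM) (hMc : lc ≤ lM)
    (hLa : la ≤ lL) (hLb : lb ≤ lL) (hLc : lc ≤ lL)
    (hL : lL ≤ Real.log 3 + lM ∧ lb ≤ lM ∨ lL ≤ Real.log 3 + lb ∧ lM ≤ lb)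
    (hD : lk + 2 * H * (lM + lb) ≤ lD)
    (hm : lm ≤ Real.log 2 + (H + H / 4) * lb + (H - H / 4) * lL) :
    (2 * H - 1) * (lL + lb) + lm - 3 / 2 * lD ≤
      -(3 / 2) * lk + Real.log 2 + 2 * Real.log 3 + lT - p * (la + lb + lc) := by
  have h3 : 0 < Real.log 3 := Real.log_pos (by norm_num)
  have h2 : 0 < Real.log 2 := Real.log_pos (by norm_num)
  have k3 := mul_nonneg (by linarith : 0 ≤ 2 - 3 * H) h3.le
  have j4 := mul_nonneg (by linarith : 0 ≤ 3 - 3 * p) hT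
  rcases hL with ⟨hL, hbM⟩ | ⟨hL, hbM⟩
  · have i1 := mul_nonneg h₀.le (sub_nonneg.2 hL)
    have i2 := mul_nonneg (by linarith : 0 ≤ 1 + H / 4) (sub_nonneg.2 hLa)
    have i3 := mul_nonneg (by linarith : 0 ≤ 1 + H / 4) (sub_nonneg.2 hLc)
    have j1 := mul_nonneg (by linarith : 0 ≤ p - (1 + H / 4) / 2) (sub_nonneg.2 ha)
    have j2 := mul_nonneg (by linarith : 0 ≤ p - (1 - H / 4)) (sub_nonneg.2 hb)
    have j3 := mul_nonneg (by linarith : 0 ≤ p - (1 + H / 4) / 2) (sub_nonneg.2 hc)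
    linarith
  · have i0 := mul_nonneg h₀.le (sub_nonneg.2 hLb)
    have i1 := mul_nonneg (by linarith : 0 ≤ 2 - 3 * H) (sub_nonneg.2 hLb)
    have i2 := mul_nonneg (by linarith : 0 ≤ 1 + 3 / 2 * H) (sub_nonneg.2 hMa)
    have i3 := mul_nonneg (by linarith : 0 ≤ 1 + 3 / 2 * H) (sub_nonneg.2 hMc)
    have i4 := mul_nonneg (by linarith : 0 ≤ 1 - 3 / 2 * H) (sub_nonneg.2 hbM)
    have j1 := mul_nonneg (by linarith : 0 ≤ p - (1 / 2 + 3 / 4 * H)) (sub_nonneg.2 ha)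
    have j2 := mul_nonneg (by linarith : 0 ≤ p - (1 - 3 / 2 * H)) (sub_nonneg.2 hb)
    have j3 := mul_nonneg (by linarith : 0 ≤ p - (1 / 2 + 3 / 4 * H)) (sub_nonneg.2 hc)
    linarith

/-! ### Pointwise bound on the second-moment kernel -/

theorem log_le_of_sq_le_rpow {H m x y : ℝ} (hm : 0 < m) (hx : 0 < x) (hy : 0 < y)
    (h : m ^ 2 ≤ x ^ (2 * H) * y ^ (2 * H)) : Real.log m ≤ H * (Real.log x + Real.log y) := by
  have := Real.log_le_log (by positivity) h
  rw [Real.log_pow, Real.log_mul (by positivity) (by positivity), Real.log_rpow hx,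
    Real.log_rpow hy] at this
  push_cast at this
  linarith

theorem incrDet_pos {H s r s' r' : ℝ} (h₀ : 0 < H) (h₁ : H < 1) (h1 : s ≠ r) (h2 : s ≠ s')
    (h3 : s ≠ r') (h4 : s' ≠ r') : 0 < incrDet H s r s' r' := by
  obtain ⟨k, hk, h⟩ := exists_pos_mul_le_incrDet h₀ h₁
  have a1 := abs_pos.2 (sub_ne_zero.2 h1)
  have a2 := abs_pos.2 (sub_ne_zero.2 h2)
  have a3 := abs_pos.2 (sub_ne_zero.2 h3)
  have a4 := abs_pos.2 (sub_ne_zero.2 h4)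
  refine lt_of_lt_of_le ?_ (h s r s' r' (min |s - r| (min |s - s'| |s - r'|))
    (lt_min a1 (lt_min a2 a3)) (min_le_left _ _) ((min_le_right _ _).trans (min_le_left _ _))
    ((min_le_right _ _).trans (min_le_right _ _)) h4)
  have := lt_min a1 (lt_min a2 a3)
  positivity

/-- With s' < s the intervals overlap, are nested or are disjoint. The first two cases give the
first two alternatives. Disjoint intervals give the last two, according to whether the gap or the
length s - r is larger, which decides what controls s - s'. One constant serves all cases. -/
theorem exists_kernel_le_of_lt {H p T : ℝ} (h₀ : 0 < H) (h₁ : H < 2 / 3) (hp1 : p < 1)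
    (hp : 1 / 2 + 3 / 4 * H ≤ p) (hp' : 1 - H / 4 ≤ p) (hT : 1 ≤ T) :
    ∃ C : ℝ, 0 < C ∧ ∀ s r s' r' : ℝ, s ≤ T → 0 ≤ r → 0 ≤ r' → r < s → r' < s' → s' < s → r ≠ r' →
      r ≠ s' →
      ((s - r) ^ (2 * H - 1) * (s' - r') ^ (2 * H - 1) * |incrCov H s r s' r'| /
        incrDet H s r s' r' ^ (3 / 2 : ℝ) ≤
          C * (|r - r'| ^ (-p) * |s' - r| ^ (-p) * |s - s'| ^ (-p))) ∨
      ((s - r) ^ (2 * H - 1) * (s' - r') ^ (2 * H - 1) * |incrCov H s r s' r'| /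
        incrDet H s r s' r' ^ (3 / 2 : ℝ) ≤
          C * (|r - r'| ^ (-p) * |s' - r'| ^ (-p) * |s - s'| ^ (-p))) ∨
      ((s - r) ^ (2 * H - 1) * (s' - r') ^ (2 * H - 1) * |incrCov H s r s' r'| /
        incrDet H s r s' r' ^ (3 / 2 : ℝ) ≤
          C * (|s - r| ^ (-p) * |s' - r'| ^ (-p) * |s - s'| ^ (-p))) ∨
      ((s - r) ^ (2 * H - 1) * (s' - r') ^ (2 * H - 1) * |incrCov H s r s' r'| /
        incrDet H s r s' r' ^ (3 / 2 : ℝ) ≤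
          C * (|s' - r| ^ (-p) * |s' - r'| ^ (-p) * |s - s'| ^ (-p))) := by
  have hH1 : H < 1 := by linarith
  obtain ⟨k, hk, hdet⟩ := exists_pos_mul_le_incrDet h₀ hH1
  refine ⟨Real.exp (-(3 / 2) * Real.log k + Real.log 2 + 2 * Real.log 3 + Real.log T),
    Real.exp_pos _, fun s r s' r' hsT hr hr' hrs hrs' hss hrr hrs2 ↦ ?_⟩
  have hlT : 0 ≤ Real.log T := Real.log_nonneg hT
  have h3 : 0 < Real.log 3 := Real.log_pos (by norm_num)
  have h2 : 0 < Real.log 2 := Real.log_pos (by norm_num)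
  have lT : ∀ z, 0 < z → z ≤ T → Real.log z ≤ Real.log T := fun z hz h ↦ Real.log_le_log hz h
  have hDpos : 0 < incrDet H s r s' r' :=
    incrDet_pos h₀ hH1 hrs.ne' hss.ne' (hrs'.trans hss).ne' hrs'.ne'
  set m := incrCov H s r s' r' with hm
  rcases eq_or_ne m 0 with hm0 | hm0
  · left
    rw [hm0, abs_zero, mul_zero, zero_div]
    positivity
  have hmpos : 0 < |m| := abs_pos.2 hm0
  have hx : 0 < s - r := by linarith
  have hy : 0 < s' - r' := by linarith
  have hcs : |m| ^ 2 ≤ (s - r) ^ (2 * H) * (s' - r') ^ (2 * H) := by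
    have := hDpos.le
    rw [incrDet, abs_of_pos hx, abs_of_pos hy, ← hm, ← sq_abs m] at this
    linarith
  have hlm := log_le_of_sq_le_rpow hmpos hx hy hcs
  -- The three determinant bounds single out s, r and r' respectively.
  have hdet1 : ∀ d, 0 < d → d ≤ |s - r| → d ≤ |s - s'| → d ≤ |s - r'| →
      Real.log k + 2 * H * (Real.log d + Real.log (s' - r')) ≤ Real.log (incrDet H s r s' r') := by
    intro d hd d1 d2 d3
    have := hdet s r s' r' d hd d1 d2 d3 hrs'.ne'
    rw [abs_of_pos hy] at this
    exact log_add_mul_log_add_mul_log_le hk hd hy this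
  have hdet2 : ∀ d, 0 < d → d ≤ |r - s| → d ≤ |r - s'| → d ≤ |r - r'| →
      Real.log k + 2 * H * (Real.log d + Real.log (s' - r')) ≤ Real.log (incrDet H s r s' r') := by
    intro d hd d1 d2 d3
    have := hdet r s s' r' d hd d1 d2 d3 hrs'.ne'
    rw [abs_of_pos hy, incrDet_flip] at this
    exact log_add_mul_log_add_mul_log_le hk hd hy this
  have hdet3 : ∀ d, 0 < d → d ≤ |r' - s'| → d ≤ |r' - s| → d ≤ |r' - r| →
      Real.log k + 2 * H * (Real.log d + Real.log (s - r)) ≤ Real.log (incrDet H s r s' r') := by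
    intro d hd d1 d2 d3
    have := hdet r' s' s r d hd d1 d2 d3 hrs.ne'
    rw [abs_of_pos hx, incrDet_flip, incrDet_swap] at this
    exact log_add_mul_log_add_mul_log_le hk hd hx this
  rcases lt_or_gt_of_ne hrs2 with hrs2 | hrs2
  · rcases lt_or_gt_of_ne hrr with hrr | hrr
    · -- nested intervals
      right; left
      have ha : 0 < r' - r := by linarith
      have hc : 0 < s - s' := by linarith
      rw [abs_sub_comm r r', abs_of_pos ha, abs_of_pos hy, abs_of_pos hc]
      refine rpow_mul_div_le_of_log_le hx hy hmpos hDpos (Real.exp_pos _) ha hy hc ?_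
      rw [Real.log_exp]
      have hMpos : 0 < max (r' - r) (s - s') := lt_max_of_lt_left ha
      have hlm' : Real.log |m| ≤ Real.log 2 + (H + H / 4) * Real.log (s' - r') +
          (H - H / 4) * Real.log (s - r) := by
        have b1 := add_rpow_sub_rpow_le (H := H) (δ := H / 4) (b := s' - r') (c := s - s')
          (L := s - r) hH1 (by linarith) (by linarith) (by linarith) hy hc (by linarith)
        have b2 := add_rpow_sub_rpow_le (H := H) (δ := H / 4) (b := s' - r') (c := r' - r)
          (L := s - r) hH1 (by linarith) (by linarith) (by linarith) hy ha (by linarith)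
        have c1 : (s - s') ^ (2 * H) ≤ (s' - r' + (s - s')) ^ (2 * H) := by gcongr; linarith
        have c2 : (r' - r) ^ (2 * H) ≤ (s' - r' + (r' - r)) ^ (2 * H) := by gcongr; linarith
        have hmle : |m| ≤ 2 * ((s' - r') ^ (H + H / 4) * (s - r) ^ (H - H / 4)) := by
          have e : m = 1 / 2 * (((s' - r' + (s - s')) ^ (2 * H) - (s - s') ^ (2 * H)) +
              ((s' - r' + (r' - r)) ^ (2 * H) - (r' - r) ^ (2 * H))) := by
            rw [hm, incrCov, abs_of_pos (by linarith : 0 < s - r'), abs_sub_comm r s',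
              abs_of_pos (by linarith : 0 < s' - r), abs_of_pos hc, abs_sub_comm r r',
              abs_of_pos ha, show s' - r' + (s - s') = s - r' by ring,
              show s' - r' + (r' - r) = s' - r by ring]
            ring
          rw [abs_of_nonneg (by rw [e]; linarith), e]
          linarith
        have := Real.log_le_log hmpos hmle
        rw [Real.log_mul (by positivity) (by positivity), Real.log_mul (by positivity)
          (by positivity), Real.log_rpow hy, Real.log_rpow hx] at this
        linarith
      refine kernel_log_nested (lM := Real.log (max (r' - r) (s - s'))) h₀ hp1 hp hp' hlT
        (lT _ ha (by linarith)) (lT _ hy (by linarith)) (lT _ hc (by linarith))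
        (Real.log_le_log ha (le_max_left _ _)) (Real.log_le_log hc (le_max_right _ _))
        (Real.log_le_log ha (by linarith)) (Real.log_le_log hy (by linarith))
        (Real.log_le_log hc (by linarith)) ?_ ?_ hlm'
      · rw [← Real.log_mul (by norm_num) hMpos.ne', ← Real.log_mul (by norm_num) hy.ne']
        rcases le_total (s' - r') (max (r' - r) (s - s')) with h | h
        · exact Or.inl ⟨Real.log_le_log hx (by
            linarith [le_max_left (r' - r) (s - s'), le_max_right (r' - r) (s - s')]),
            Real.log_le_log hy h⟩
        · exact Or.inr ⟨Real.log_le_log hx (by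
            linarith [le_max_left (r' - r) (s - s'), le_max_right (r' - r) (s - s')]),
            Real.log_le_log hMpos h⟩
      · rcases le_total (r' - r) (s - s') with h | h
        · rw [max_eq_right h]
          exact hdet1 _ hc (by rw [abs_of_pos hx]; linarith) (by rw [abs_of_pos hc])
            (by rw [abs_of_pos (by linarith : 0 < s - r')]; linarith)
        · rw [max_eq_left h]
          exact hdet2 _ ha (by rw [abs_sub_comm, abs_of_pos hx]; linarith)
            (by rw [abs_sub_comm, abs_of_pos (by linarith : 0 < s' - r)]; linarith)
            (by rw [abs_sub_comm, abs_of_pos ha])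
    · -- overlapping intervals
      left
      have ha : 0 < r - r' := by linarith
      have hb : 0 < s' - r := by linarith
      have hc : 0 < s - s' := by linarith
      rw [abs_of_pos ha, abs_of_pos hb, abs_of_pos hc]
      refine rpow_mul_div_le_of_log_le hx hy hmpos hDpos (Real.exp_pos _) ha hb hc ?_
      rw [Real.log_exp]
      have := kernel_log_overlap (lk := Real.log k) (lT := Real.log T) hp1 hp hp' hlT
        (lT _ ha (by linarith)) (lT _ hb (by linarith)) (lT _ hc (by linarith))
        (Real.log_le_log ha (by linarith : _ ≤ s' - r'))
        (Real.log_le_log hb (by linarith : _ ≤ s' - r'))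
        (Real.log_le_log hb (by linarith : _ ≤ s - r))
        (Real.log_le_log hc (by linarith : _ ≤ s - r))
        (hdet1 _ hc (by rw [abs_of_pos hx]; linarith) (by rw [abs_of_pos hc])
            (by rw [abs_of_pos (by linarith : 0 < s - r')]; linarith))
        (hdet3 _ ha (by rw [abs_sub_comm, abs_of_pos hy]; linarith)
            (by rw [abs_sub_comm, abs_of_pos (by linarith : 0 < s - r')]; linarith)
            (by rw [abs_sub_comm, abs_of_pos ha])) hlm
      linarith
  · -- disjoint intervals
    right; right
    have hg : 0 < r - s' := by linarith
    have hc : 0 < s - s' := by linarith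
    have hD := hdet3 _ hy (by rw [abs_sub_comm, abs_of_pos hy])
      (by rw [abs_sub_comm, abs_of_pos (by linarith : 0 < s - r')]; linarith)
      (by rw [abs_sub_comm, abs_of_pos (by linarith : 0 < r - r')]; linarith)
    have hlm' : Real.log |m| ≤ Real.log (s - r) + Real.log (s' - r') +
        (2 * H - 2) * Real.log (r - s') := by
      have b := abs_rpow_second_difference_le h₀ hH1 hx hy hg
      have e : m = 1 / 2 * ((s - r + (r - s') + (s' - r')) ^ (2 * H) + (r - s') ^ (2 * H) -
          (s - r + (r - s')) ^ (2 * H) - (r - s' + (s' - r')) ^ (2 * H)) := by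
        rw [hm, incrCov, abs_of_pos (by linarith : 0 < s - r'), abs_of_pos hg, abs_of_pos hc,
          abs_of_pos (by linarith : 0 < r - r'), show s - r + (r - s') + (s' - r') = s - r' by ring,
          show s - r + (r - s') = s - s' by ring, show r - s' + (s' - r') = r - r' by ring]
      have hmle : |m| ≤ (s - r) * (s' - r') * (r - s') ^ (2 * H - 2) := by
        rw [e, abs_mul, abs_of_pos (by norm_num : (0 : ℝ) < 1 / 2)]
        linarith
      have := Real.log_le_log hmpos hmle
      rwa [Real.log_mul (by positivity) (by positivity), Real.log_mul (by positivity)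
          (by positivity), Real.log_rpow hg] at this
    have main := fun lz lc h ↦ kernel_log_disjoint (lk := Real.log k) (lT := Real.log T) (lz := lz)
      (lc := lc) h₁ hp1 hp' hlT
      (lT _ hx (by linarith)) (lT _ hy (by linarith)) (lT _ hg (by linarith)) h hD hlm hlm'
    rcases le_total (s - r) (r - s') with h | h
    · left
      rw [abs_of_pos hx, abs_of_pos hy, abs_of_pos hc]
      refine rpow_mul_div_le_of_log_le hx hy hmpos hDpos (Real.exp_pos _) hx hy hc ?_
      rw [Real.log_exp]
      have := main (Real.log (s - r)) (Real.log (s - s')) (Or.inl ⟨by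
        rw [← Real.log_mul (by norm_num) hg.ne']; exact Real.log_le_log hc (by linarith), rfl⟩)
      linarith
    · right
      rw [abs_sub_comm s' r, abs_of_pos hg, abs_of_pos hy, abs_of_pos hc]
      refine rpow_mul_div_le_of_log_le hx hy hmpos hDpos (Real.exp_pos _) hg hy hc ?_
      rw [Real.log_exp]
      have := main (Real.log (r - s')) (Real.log (s - s')) (Or.inr ⟨by
        rw [← Real.log_mul (by norm_num) hx.ne']; exact Real.log_le_log hc (by linarith), rfl⟩)
      linarith

/-! ### Integrability of the dominating kernel -/

/-- The singular weight `|z| ^ (-p)`, equal to `∞` at `0`. -/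
noncomputable def singWeight (p z : ℝ) : ℝ≥0∞ := ENNReal.ofReal |z| ^ (-p)

@[fun_prop]
theorem measurable_singWeight (p : ℝ) : Measurable (singWeight p) := by
  unfold singWeight; fun_prop

theorem singWeight_sub_comm (p x y : ℝ) : singWeight p (x - y) = singWeight p (y - x) := by
  simp only [singWeight, abs_sub_comm]

theorem singWeight_zero {p : ℝ} (hp : 0 < p) : singWeight p 0 = ∞ := by
  simp [singWeight, hp]

theorem singWeight_ne_zero {p : ℝ} (hp : 0 < p) (z : ℝ) : singWeight p z ≠ 0 := by
  simp [singWeight, ENNReal.rpow_eq_zero_iff, hp, hp.le]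

theorem singWeight_of_ne_zero {z : ℝ} (p : ℝ) (hz : z ≠ 0) :
    singWeight p z = ENNReal.ofReal (|z| ^ (-p)) := by
  rw [singWeight, ENNReal.ofReal_rpow_of_pos (abs_pos.2 hz)]

/-- The dominating kernel for second moments of the derivative of self-intersection local time. -/
noncomputable def domKernel (p s r s' r' : ℝ) : ℝ≥0∞ :=
  singWeight p (s - s') * (singWeight p (r - r') * (singWeight p (s' - r) + singWeight p (s' - r') +
    singWeight p (s - r') + singWeight p (s - r)) +
    (singWeight p (s - r) + singWeight p (s' - r)) *
      (singWeight p (s' - r') + singWeight p (s - r')))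

theorem domKernel_swap (p s r s' r' : ℝ) : domKernel p s' r' s r = domKernel p s r s' r' := by
  simp only [domKernel, singWeight_sub_comm p s' s, singWeight_sub_comm p r' r]
  ring

/-- The value ∞ of the weight at 0 makes every domination by `domKernel` automatic when a time of
one interval coincides with a time of the other, so these degenerate points need no separate
null-set argument. -/
theorem domKernel_eq_top {p s r s' r' : ℝ} (hp : 0 < p)
    (h : s = s' ∨ r = r' ∨ s' = r ∨ s = r') : domKernel p s r s' r' = ∞ := by
  have h0 := singWeight_ne_zero hp
  have ht := singWeight_zero hp
  unfold domKernel
  rcases h with rfl | rfl | rfl | rfl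
  · rw [sub_self, ht, ENNReal.top_mul]
    simp [h0]
  all_goals
    refine ENNReal.mul_eq_top.2 (Or.inl ⟨h0 _, ?_⟩)
    simp only [sub_self, ht]
    simp [h0]

theorem ofReal_mul_rpow_eq {p C x y z : ℝ} (hC : 0 ≤ C) (hx : x ≠ 0) (hy : y ≠ 0) (hz : z ≠ 0) :
    ENNReal.ofReal (C * (|x| ^ (-p) * |y| ^ (-p) * |z| ^ (-p))) =
      ENNReal.ofReal C * (singWeight p z * (singWeight p x * singWeight p y)) := by
  rw [singWeight_of_ne_zero p hx, singWeight_of_ne_zero p hy, singWeight_of_ne_zero p hz,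
    ENNReal.ofReal_mul hC, ENNReal.ofReal_mul (by positivity), ENNReal.ofReal_mul (by positivity)]
  ring

theorem ofReal_le_mul_domKernel {p C K s r s' r' : ℝ} (hC : 0 < C) (h1 : s ≠ r) (h2 : s' ≠ r')
    (h3 : s ≠ s') (h4 : r ≠ r') (h5 : s' ≠ r)
    (h : K ≤ C * (|r - r'| ^ (-p) * |s' - r| ^ (-p) * |s - s'| ^ (-p)) ∨
      K ≤ C * (|r - r'| ^ (-p) * |s' - r'| ^ (-p) * |s - s'| ^ (-p)) ∨
      K ≤ C * (|s - r| ^ (-p) * |s' - r'| ^ (-p) * |s - s'| ^ (-p)) ∨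
      K ≤ C * (|s' - r| ^ (-p) * |s' - r'| ^ (-p) * |s - s'| ^ (-p))) :
    ENNReal.ofReal K ≤ ENNReal.ofReal C * domKernel p s r s' r' := by
  rw [← sub_ne_zero] at h1 h2 h3 h4 h5
  unfold domKernel
  rcases h with h | h | h | h
  all_goals
    refine (ENNReal.ofReal_le_ofReal h).trans ?_
    rw [ofReal_mul_rpow_eq hC.le (by assumption) (by assumption) (by assumption)]
    gcongr
  · exact le_add_right (mul_le_mul_right (le_add_right (le_add_right (le_add_right le_rfl))) _)
  · exact le_add_right (mul_le_mul_right (le_add_right (le_add_right (le_add_left le_rfl))) _)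
  · exact le_add_left (mul_le_mul' (le_add_right le_rfl) (le_add_right le_rfl))
  · exact le_add_left (mul_le_mul' (le_add_left le_rfl) (le_add_right le_rfl))

/-- Adding ε and η enlarges the determinant, so the unregularized bound applies. The case s < s'
follows by exchanging the two intervals, under which `domKernel` is symmetric. -/
theorem exists_ofReal_kernel_le {H p T : ℝ} (h₀ : 0 < H) (h₁ : H < 2 / 3) (hp1 : p < 1)
    (hp : 1 / 2 + 3 / 4 * H ≤ p) (hp' : 1 - H / 4 ≤ p) (hT : 1 ≤ T) :
    ∃ C : ℝ, 0 < C ∧ ∀ s r s' r' ε η : ℝ, s ≤ T → s' ≤ T → 0 ≤ r → 0 ≤ r' → r < s → r' < s' →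
      0 ≤ ε → 0 ≤ η →
      ENNReal.ofReal ((s - r) ^ (2 * H - 1) * (s' - r') ^ (2 * H - 1) * |incrCov H s r s' r'| /
        ((|s - r| ^ (2 * H) + ε) * (|s' - r'| ^ (2 * H) + η) - incrCov H s r s' r' ^ 2) ^
          (3 / 2 : ℝ)) ≤ ENNReal.ofReal C * domKernel p s r s' r' := by
  obtain ⟨C, hC, h⟩ := exists_kernel_le_of_lt h₀ h₁ hp1 hp hp' hT
  have hp0 : 0 < p := by linarith
  refine ⟨C, hC, fun s r s' r' ε η hs hs' hr hr' hrs hrs' hε hη ↦ ?_⟩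
  by_cases hdeg : s = s' ∨ r = r' ∨ s' = r ∨ s = r'
  · rw [domKernel_eq_top hp0 hdeg, ENNReal.mul_top (by simpa using hC)]
    exact le_top
  push Not at hdeg
  obtain ⟨d1, d2, d3, d4⟩ := hdeg
  have hD := incrDet_pos h₀ (by linarith) hrs.ne' d1 d4 hrs'.ne'
  have hw : 0 < (s - r) ^ (2 * H - 1) := Real.rpow_pos_of_pos (by linarith) _
  have hw' : 0 < (s' - r') ^ (2 * H - 1) := Real.rpow_pos_of_pos (by linarith) _
  refine le_trans (ENNReal.ofReal_le_ofReal (q := (s - r) ^ (2 * H - 1) * (s' - r') ^ (2 * H - 1) *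
    |incrCov H s r s' r'| / incrDet H s r s' r' ^ (3 / 2 : ℝ)) ?_) ?_
  · have : incrDet H s r s' r' ≤ (|s - r| ^ (2 * H) + ε) * (|s' - r'| ^ (2 * H) + η) -
        incrCov H s r s' r' ^ 2 := by
      rw [incrDet]
      gcongr <;> linarith
    gcongr
  · rcases lt_or_gt_of_ne d1 with hlt | hlt
    · have := ofReal_le_mul_domKernel hC hrs'.ne' hrs.ne' d1.symm d2.symm d4
        (h s' r' s r hs' hr' hr hrs' hrs hlt d2.symm d4.symm)
      rwa [domKernel_swap, incrCov_swap, incrDet_swap, mul_comm ((s' - r') ^ (2 * H - 1))] at this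
    · exact ofReal_le_mul_domKernel hC hrs.ne' hrs'.ne' d1 d2 d3
        (h s r s' r' hs hr hr' hrs hrs' hlt d2 d3.symm)

theorem setLIntegral_singWeight_le {p a b y : ℝ} (hp1 : p < 1) (hy : y ∈ Set.Ioc a b) :
    ∫⁻ z in Set.Ioc a b, singWeight p (y - z) ≤
      ENNReal.ofReal (2 / (1 - p) * (b - a) ^ (1 - p)) := by
  have hq : 0 < 1 - p := by linarith
  have key : ∀ c : ℝ, 0 ≤ c → ∫⁻ z in Set.Ioc 0 c, singWeight p z ≤
      ENNReal.ofReal (1 / (1 - p) * c ^ (1 - p)) := by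
    intro c hc
    have hi : IntegrableOn (fun z : ℝ ↦ z ^ (-p)) (Set.Ioc 0 c) :=
      (intervalIntegrable_iff_integrableOn_Ioc_of_le hc).1
        (intervalIntegral.intervalIntegrable_rpow' (by linarith))
    have e : ∫⁻ z in Set.Ioc 0 c, singWeight p z = ∫⁻ z in Set.Ioc 0 c, ENNReal.ofReal (z ^ (-p)) :=
      setLIntegral_congr_fun measurableSet_Ioc fun z hz ↦ by
        rw [singWeight_of_ne_zero p hz.1.ne', abs_of_pos hz.1]
    rw [e, ← ofReal_integral_eq_lintegral_ofReal hi
      ((ae_restrict_mem measurableSet_Ioc).mono fun z hz ↦ Real.rpow_nonneg hz.1.le _),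
      ← intervalIntegral.integral_of_le hc, integral_rpow (Or.inl (by linarith))]
    refine ENNReal.ofReal_le_ofReal (le_of_eq ?_)
    rw [show -p + 1 = 1 - p by ring, Real.zero_rpow hq.ne']
    ring
  have e1 : ∫⁻ z in Set.Ioc a y, singWeight p (y - z) =
      ∫⁻ z in Set.Ico 0 (y - a), singWeight p z := by
    have := (Measure.measurePreserving_sub_left volume y).setLIntegral_comp_preimage
      (s := Set.Ico 0 (y - a)) measurableSet_Ico (measurable_singWeight p)
    rw [← this]
    congr 2
    ext z; simp only [Set.mem_Ioc, Set.mem_preimage, Set.mem_Ico]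
    constructor <;> rintro ⟨h1, h2⟩ <;> constructor <;> linarith
  have e2 : ∫⁻ z in Set.Ioc y b, singWeight p (y - z) =
      ∫⁻ z in Set.Ioc 0 (b - y), singWeight p z := by
    have := (measurePreserving_sub_right volume y).setLIntegral_comp_preimage
      (s := Set.Ioc 0 (b - y)) measurableSet_Ioc (measurable_singWeight p)
    rw [← this]
    simp_rw [singWeight_sub_comm p y]
    congr 2
    ext z; simp only [Set.mem_Ioc, Set.mem_preimage]
    constructor <;> rintro ⟨h1, h2⟩ <;> constructor <;> linarith
  have h1 : (y - a) ^ (1 - p) ≤ (b - a) ^ (1 - p) := by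
    gcongr
    · linarith [hy.1]
    · exact hy.2
  have h2 : (b - y) ^ (1 - p) ≤ (b - a) ^ (1 - p) := by
    gcongr
    · linarith [hy.2]
    · exact hy.1.le
  rw [← Set.Ioc_union_Ioc_eq_Ioc hy.1.le hy.2,
    lintegral_union measurableSet_Ioc (Set.Ioc_disjoint_Ioc_of_le le_rfl), e1, e2,
    setLIntegral_congr Ico_ae_eq_Ioc]
  refine (add_le_add (key _ (by linarith [hy.1])) (key _ (by linarith [hy.2]))).trans ?_
  rw [← ENNReal.ofReal_add (by have := hy.1; positivity) (by have := hy.2; positivity)]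
  refine ENNReal.ofReal_le_ofReal ?_
  have : 0 < 1 / (1 - p) := by positivity
  calc _ ≤ 1 / (1 - p) * (b - a) ^ (1 - p) + 1 / (1 - p) * (b - a) ^ (1 - p) := by gcongr
    _ = _ := by ring

/-- Expanded, the kernel is the sum over the eight spanning trees on {s, r, s', r'} containing the
edge ss'. This grouping shows which of r, r' is a leaf and can be integrated out first. -/
theorem domKernel_eq (p s r s' r' : ℝ) : domKernel p s r s' r' =
    singWeight p (s - s') *
      (singWeight p (r - r') * (singWeight p (s' - r) + singWeight p (s - r)) +
       (singWeight p (s' - r') + singWeight p (s - r')) * singWeight p (r' - r) +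
        (singWeight p (s' - r) + singWeight p (s - r)) *
          (singWeight p (s' - r') + singWeight p (s - r'))) := by
  rw [domKernel, singWeight_sub_comm p r' r]; ring

theorem measurable_domKernel (p : ℝ) :
    Measurable fun z : (ℝ × ℝ) × (ℝ × ℝ) ↦ domKernel p z.1.1 z.1.2 z.2.1 z.2.2 := by
  unfold domKernel; fun_prop

/-- Removing the leaves of a tree one at a time costs a factor c each, uniformly in the neighbouring
vertex; eight trees give 8c². -/
theorem setLIntegral_setLIntegral_domKernel_le {p T s s' : ℝ} {c : ℝ≥0∞}
    (hcT : ∀ y ∈ Set.Ioc 0 T, ∫⁻ z in Set.Ioc 0 T, singWeight p (y - z) ≤ c)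
    (hs : s ∈ Set.Ioc 0 T) (hs' : s' ∈ Set.Ioc 0 T) :
    ∫⁻ r in Set.Ioc 0 T, ∫⁻ r' in Set.Ioc 0 T, domKernel p s r s' r' ≤
      singWeight p (s - s') * (8 * c ^ 2) := by
  set F : ℝ → ℝ≥0∞ := fun z ↦ singWeight p (s' - z) + singWeight p (s - z) with hF
  have hFm : Measurable F := by fun_prop
  have hFi : ∫⁻ z in Set.Ioc 0 T, F z ≤ 2 * c := by
    rw [lintegral_add_left (by fun_prop), two_mul]
    exact add_le_add (hcT _ hs') (hcT _ hs)
  set ν := (volume : Measure ℝ).restrict (Set.Ioc 0 T) with hν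
  have e : ∀ r, ∫⁻ r', domKernel p s r s' r' ∂ν =
      singWeight p (s - s') * ((∫⁻ r', singWeight p (r - r') ∂ν) * F r +
        ∫⁻ r', F r' * singWeight p (r' - r) ∂ν + F r * ∫⁻ r', F r' ∂ν) := by
    intro r
    simp_rw [domKernel_eq]
    rw [lintegral_const_mul _ (by fun_prop), lintegral_add_left (by fun_prop),
      lintegral_add_left (by fun_prop), lintegral_mul_const _ (by fun_prop),
      lintegral_const_mul _ (by fun_prop)]
  have hm1 : Measurable fun r ↦ ∫⁻ r', singWeight p (r - r') ∂ν :=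
    Measurable.lintegral_prod_right' (f := fun z : ℝ × ℝ ↦ singWeight p (z.1 - z.2)) (by fun_prop)
  have hm2 : Measurable fun r ↦ ∫⁻ r', F r' * singWeight p (r' - r) ∂ν :=
    Measurable.lintegral_prod_right' (f := fun z : ℝ × ℝ ↦ F z.2 * singWeight p (z.2 - z.1))
      (by fun_prop)
  have i1 : ∫⁻ r, (∫⁻ r', singWeight p (r - r') ∂ν) * F r ∂ν ≤ c * (2 * c) := by
    calc _ ≤ ∫⁻ r, c * F r ∂ν := by
          refine lintegral_mono_ae ?_
          filter_upwards [ae_restrict_mem measurableSet_Ioc] with r hr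
          gcongr
          exact hcT r hr
      _ ≤ c * (2 * c) := by rw [lintegral_const_mul _ hFm]; gcongr
  have i2 : ∫⁻ r, ∫⁻ r', F r' * singWeight p (r' - r) ∂ν ∂ν ≤ 2 * c * c := by
    rw [lintegral_lintegral_swap (by fun_prop)]
    calc _ ≤ ∫⁻ r', F r' * c ∂ν := by
          refine lintegral_mono_ae ?_
          filter_upwards [ae_restrict_mem measurableSet_Ioc] with r hr
          rw [lintegral_const_mul _ (by fun_prop)]
          gcongr
          exact hcT r hr
      _ ≤ 2 * c * c := by rw [lintegral_mul_const _ hFm]; gcongr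
  have i3 : ∫⁻ r, F r * ∫⁻ r', F r' ∂ν ∂ν ≤ 2 * c * (2 * c) := by
    rw [lintegral_mul_const _ hFm]; gcongr
  simp_rw [e]
  rw [lintegral_const_mul _ (by fun_prop), lintegral_add_left (by fun_prop),
    lintegral_add_left (by fun_prop)]
  gcongr
  calc _ ≤ c * (2 * c) + 2 * c * c + 2 * c * (2 * c) := by gcongr
    _ = 8 * c ^ 2 := by ring

/-- The domain `{(s, r) : a < s ≤ b, 0 < r ≤ T}` with Lebesgue measure. -/
noncomputable def boxMeasure (a b T : ℝ) : Measure (ℝ × ℝ) :=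
  (volume.restrict (Set.Ioc a b)).prod (volume.restrict (Set.Ioc 0 T))

theorem exists_lintegral_domKernel_le {p : ℝ} (hp1 : p < 1) (T : ℝ) :
    ∃ C : ℝ, 0 < C ∧ ∀ a b : ℝ, 0 ≤ a → a ≤ b → b ≤ T →
      ∫⁻ z, domKernel p z.1.1 z.1.2 z.2.1 z.2.2 ∂((boxMeasure a b T).prod (boxMeasure a b T)) ≤
        ENNReal.ofReal (C * (b - a) ^ (2 - p)) := by
  have hq : 0 < 1 - p := by linarith
  set c : ℝ := 2 / (1 - p) * (T - 0) ^ (1 - p) with hc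
  -- The summand 1 only ensures positivity of the constant, since c may vanish.
  refine ⟨2 / (1 - p) * (8 * c ^ 2 + 1), by positivity, fun a b ha hab hbT ↦ ?_⟩
  set va := (volume : Measure ℝ).restrict (Set.Ioc a b)
  set vT := (volume : Measure ℝ).restrict (Set.Ioc 0 T)
  have hm := measurable_domKernel p
  have hT : 0 ≤ T := by linarith
  have hc0 : 0 ≤ c := by positivity
  have hsub : Set.Ioc a b ⊆ Set.Ioc 0 T := Set.Ioc_subset_Ioc ha hbT
  have e : ∫⁻ z, domKernel p z.1.1 z.1.2 z.2.1 z.2.2 ∂((boxMeasure a b T).prod (boxMeasure a b T)) =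
      ∫⁻ s, ∫⁻ s', ∫⁻ r, ∫⁻ r', domKernel p s r s' r' ∂vT ∂vT ∂va ∂va := by
    rw [show boxMeasure a b T = va.prod vT from rfl, lintegral_prod _ hm.aemeasurable,
      lintegral_prod _ (by
      exact (Measurable.lintegral_prod_right' hm).aemeasurable)]
    refine lintegral_congr fun s ↦ ?_
    have e1 : ∀ r, ∫⁻ v, domKernel p s r v.1 v.2 ∂(va.prod vT) =
        ∫⁻ s', ∫⁻ r', domKernel p s r s' r' ∂vT ∂va := fun r ↦
      lintegral_prod (fun v : ℝ × ℝ ↦ domKernel p s r v.1 v.2)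
        (hm.comp (by fun_prop : Measurable fun v : ℝ × ℝ ↦ ((s, r), v))).aemeasurable
    simp_rw [e1]
    -- The r integral is moved inside the s' integral, so that both r and r' are eliminated for
    -- fixed s, s'.
    rw [lintegral_lintegral_swap]
    exact (Measurable.lintegral_prod_right' (f := fun w : (ℝ × ℝ) × ℝ ↦
      domKernel p s w.1.1 w.1.2 w.2) (hm.comp (by fun_prop :
        Measurable fun w : (ℝ × ℝ) × ℝ ↦ ((s, w.1.1), (w.1.2, w.2))))).aemeasurable
  rw [e]
  have hbound : ∀ y ∈ Set.Ioc 0 T, ∫⁻ z in Set.Ioc 0 T, singWeight p (y - z) ≤ ENNReal.ofReal c :=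
    fun y hy ↦ setLIntegral_singWeight_le hp1 hy
  have key : ∀ s ∈ Set.Ioc a b, ∫⁻ s', ∫⁻ r, ∫⁻ r', domKernel p s r s' r' ∂vT ∂vT ∂va ≤
      ENNReal.ofReal (2 / (1 - p) * (b - a) ^ (1 - p)) * (8 * ENNReal.ofReal c ^ 2) := by
    intro s hs
    calc _ ≤ ∫⁻ s', singWeight p (s - s') * (8 * ENNReal.ofReal c ^ 2) ∂va := by
          refine lintegral_mono_ae ?_
          filter_upwards [ae_restrict_mem measurableSet_Ioc] with s' hs'
          exact setLIntegral_setLIntegral_domKernel_le hbound (hsub hs)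
            (hsub hs')
      _ ≤ _ := by
          rw [lintegral_mul_const _ (by fun_prop)]
          gcongr
          exact setLIntegral_singWeight_le hp1 hs
  calc _ ≤ ∫⁻ _, ENNReal.ofReal (2 / (1 - p) * (b - a) ^ (1 - p)) *
        (8 * ENNReal.ofReal c ^ 2) ∂va := by
          refine lintegral_mono_ae ?_
          filter_upwards [ae_restrict_mem measurableSet_Ioc] with s hs using key s hs
    _ = ENNReal.ofReal (2 / (1 - p) * (8 * c ^ 2) * (b - a) ^ (2 - p)) := by
          have hab' : 0 ≤ b - a := by linarith
          rw [lintegral_const, Measure.restrict_apply_univ, Real.volume_Ioc,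
            show (8 : ℝ≥0∞) = ENNReal.ofReal 8 by simp, ← ENNReal.ofReal_pow hc0,
            ← ENNReal.ofReal_mul (by norm_num), ← ENNReal.ofReal_mul (by positivity),
            ← ENNReal.ofReal_mul (by positivity), show 2 - p = (1 - p) + 1 by ring,
            Real.rpow_add_one' hab' (by linarith)]
          congr 1
          ring
    _ ≤ _ := by
          have hab' : 0 ≤ b - a := by linarith
          refine ENNReal.ofReal_le_ofReal ?_
          gcongr
          linarith

/-! ### Gaussian integrals and the covariance of the smoothed derivatives -/

theorem integral_cexp_neg_half_mul_sq_add {v : ℝ} (hv : 0 < v) (a : ℂ) :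
    ∫ p : ℝ, Complex.exp (-(v / 2) * p ^ 2 + a * p) =
      (√(2 * Real.pi / v) : ℝ) * Complex.exp (a ^ 2 / (2 * v)) := by
  have hre : (-((v : ℂ) / 2)).re < 0 := by
    rw [show (-((v : ℂ) / 2)) = ((-(v / 2) : ℝ) : ℂ) by push_cast; ring, Complex.ofReal_re]
    linarith
  have h := integral_cexp_quadratic hre a 0
  simp only [add_zero] at h
  rw [h]
  have hvc : (v : ℂ) ≠ 0 := by exact_mod_cast hv.ne'
  congr 1
  · rw [Real.sqrt_eq_rpow, Complex.ofReal_cpow (by positivity)]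
    congr 1
    · push_cast; field_simp
    · push_cast; ring
  · congr 1; field_simp; ring

theorem integrable_cexp_neg_half_mul_sq_add {v : ℝ} (hv : 0 < v) (a : ℂ) :
    Integrable fun p : ℝ ↦ Complex.exp (-(v / 2) * p ^ 2 + a * p) := by
  have hre : (-((v : ℂ) / 2)).re < 0 := by
    rw [show (-((v : ℂ) / 2)) = ((-(v / 2) : ℝ) : ℂ) by push_cast; ring, Complex.ofReal_re]
    linarith
  simpa using integrable_cexp_quadratic' hre a 0

theorem integrable_sq_mul_cexp_neg_half_mul_sq_add {v : ℝ} (hv : 0 < v) (a : ℂ) :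
    Integrable fun p : ℝ ↦ (p : ℂ) ^ 2 * Complex.exp (-(v / 2) * p ^ 2 + a * p) := by
  have h1 := (integrable_cexp_neg_half_mul_sq_add hv (a + 2)).norm
  have h2 := (integrable_cexp_neg_half_mul_sq_add hv (a - 2)).norm
  refine Integrable.mono' (h1.add h2) (by fun_prop) (ae_of_all _ fun p ↦ ?_)
  have hp : p ^ 2 ≤ Real.exp (2 * p) + Real.exp (-(2 * p)) := by
    rcases le_total 0 p with h | h
    · have := Real.quadratic_le_exp_of_nonneg (by linarith : 0 ≤ 2 * p)
      nlinarith [Real.exp_pos (-(2 * p))]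
    · have := Real.quadratic_le_exp_of_nonneg (by linarith : 0 ≤ -(2 * p))
      nlinarith [Real.exp_pos (2 * p)]
  have e1 : Complex.exp (-(v / 2) * p ^ 2 + (a + 2) * p) =
      Complex.exp (-(v / 2) * p ^ 2 + a * p) * (Real.exp (2 * p) : ℝ) := by
    push_cast; rw [← Complex.exp_add]; congr 1; ring
  have e2 : Complex.exp (-(v / 2) * p ^ 2 + (a - 2) * p) =
      Complex.exp (-(v / 2) * p ^ 2 + a * p) * (Real.exp (-(2 * p)) : ℝ) := by
    push_cast; rw [← Complex.exp_add]; congr 1; ring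
  simp only [Pi.add_apply]
  rw [e1, e2, norm_mul, norm_mul, norm_mul, Complex.norm_real, Complex.norm_real,
    Real.norm_of_nonneg (Real.exp_pos _).le, Real.norm_of_nonneg (Real.exp_pos _).le, ← mul_add,
    norm_pow, Complex.norm_real, Real.norm_eq_abs, sq_abs, mul_comm]
  gcongr

theorem integrable_mul_cexp_neg_half_mul_sq_add {v : ℝ} (hv : 0 < v) (a : ℂ) :
    Integrable fun p : ℝ ↦ (p : ℂ) * Complex.exp (-(v / 2) * p ^ 2 + a * p) := by
  have h1 := (integrable_cexp_neg_half_mul_sq_add hv a).norm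
  have h2 := (integrable_sq_mul_cexp_neg_half_mul_sq_add hv a).norm
  refine Integrable.mono' (h1.add h2) (by fun_prop) (ae_of_all _ fun p ↦ ?_)
  have hp : |p| ≤ 1 + p ^ 2 := by nlinarith [sq_nonneg (|p| - 1), sq_abs p, abs_nonneg p]
  simp only [Pi.add_apply, norm_mul, norm_pow, Complex.norm_real, Real.norm_eq_abs, sq_abs]
  nlinarith [norm_nonneg (Complex.exp (-(v / 2) * p ^ 2 + a * p))]

theorem hasDerivAt_cexp_neg_half_mul_sq_add (v : ℝ) (a : ℂ) (p : ℝ) :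
    HasDerivAt (fun p : ℝ ↦ Complex.exp (-(v / 2) * p ^ 2 + a * p))
      ((a - v * p) * Complex.exp (-(v / 2) * p ^ 2 + a * p)) p := by
  have hid : HasDerivAt (fun p : ℝ ↦ (p : ℂ)) 1 p := Complex.ofRealCLM.hasDerivAt
  have h := (((hid.pow 2).const_mul (-((v : ℂ) / 2))).add (hid.const_mul a)).cexp
  refine h.congr_deriv ?_
  simp only [Pi.add_apply, Pi.pow_apply]
  push_cast; ring

/-- The derivative (a - vp) e^{-vp²/2 + ap} integrates to zero, which expresses the first moment
through the zeroth. -/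
theorem integral_mul_cexp_neg_half_mul_sq_add {v : ℝ} (hv : 0 < v) (a : ℂ) :
    ∫ p : ℝ, (p : ℂ) * Complex.exp (-(v / 2) * p ^ 2 + a * p) =
      a / v * ((√(2 * Real.pi / v) : ℝ) * Complex.exp (a ^ 2 / (2 * v))) := by
  have hvc : (v : ℂ) ≠ 0 := by exact_mod_cast hv.ne'
  have i0 := integrable_cexp_neg_half_mul_sq_add hv a
  have i1 := integrable_mul_cexp_neg_half_mul_sq_add hv a
  have e : ∀ p : ℝ, (a - v * p) * Complex.exp (-(v / 2) * p ^ 2 + a * p) =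
      a * Complex.exp (-(v / 2) * p ^ 2 + a * p) -
        v * (p * Complex.exp (-(v / 2) * p ^ 2 + a * p)) := fun p ↦ by ring
  have h := integral_eq_zero_of_hasDerivAt_of_integrable
    (hasDerivAt_cexp_neg_half_mul_sq_add v a)
    (by simp_rw [e]; exact (i0.const_mul a).sub (i1.const_mul _)) i0
  simp_rw [e] at h
  rw [integral_sub (i0.const_mul a) (i1.const_mul _), integral_const_mul, integral_const_mul,
    integral_cexp_neg_half_mul_sq_add hv] at h
  generalize (∫ p : ℝ, (p : ℂ) * Complex.exp (-(v / 2) * p ^ 2 + a * p)) = J at h ⊢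
  rw [div_mul_eq_mul_div, eq_div_iff hvc]
  linear_combination -h

theorem integral_sq_mul_cexp_neg_half_mul_sq {v : ℝ} (hv : 0 < v) :
    ∫ p : ℝ, (p : ℂ) ^ 2 * Complex.exp (-(v / 2) * p ^ 2) =
      ((1 / v * √(2 * Real.pi / v) : ℝ) : ℂ) := by
  have hvc : (v : ℂ) ≠ 0 := by exact_mod_cast hv.ne'
  have i0 := integrable_cexp_neg_half_mul_sq_add hv 0
  have i1 := integrable_mul_cexp_neg_half_mul_sq_add hv 0
  have i2 := integrable_sq_mul_cexp_neg_half_mul_sq_add hv 0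
  have v0 := integral_cexp_neg_half_mul_sq_add hv 0
  have hd := hasDerivAt_cexp_neg_half_mul_sq_add v 0
  simp only [zero_mul, add_zero, zero_sub] at i0 i1 i2 v0 hd
  have e : ∀ p : ℝ, 1 * Complex.exp (-(v / 2) * p ^ 2) +
      p * (-(v * p) * Complex.exp (-(v / 2) * p ^ 2)) =
      Complex.exp (-(v / 2) * p ^ 2) - v * (p ^ 2 * Complex.exp (-(v / 2) * p ^ 2)) :=
    fun p ↦ by ring
  have h := integral_eq_zero_of_hasDerivAt_of_integrable
    (fun p : ℝ ↦ (Complex.ofRealCLM.hasDerivAt (x := p)).mul (hd p))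
    (by simp only [Complex.ofRealCLM_apply, Complex.ofReal_one]; simp_rw [e]
        exact i0.sub (i2.const_mul _)) i1
  simp only [Complex.ofRealCLM_apply, Complex.ofReal_one] at h
  simp_rw [e] at h
  rw [integral_sub i0 (i2.const_mul _), integral_const_mul, v0] at h
  generalize (∫ p : ℝ, (p : ℂ) ^ 2 * Complex.exp (-(v / 2) * p ^ 2)) = J at h ⊢
  rw [zero_pow two_ne_zero, zero_div, Complex.exp_zero] at h
  push_cast
  rw [one_div, inv_mul_eq_div, eq_div_iff hvc]
  linear_combination -h

theorem deriv_gaussKernel {ε : ℝ} (x : ℝ) :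
    deriv (gaussKernel ε) x = -(x / ε) * gaussKernel ε x := by
  have h : HasDerivAt (gaussKernel ε) (1 / Real.sqrt (2 * Real.pi * ε) *
      (Real.exp (-(1 / 2) * x ^ 2 / ε) * (-(1 / 2) * (2 * x) / ε))) x := by
    have := ((((hasDerivAt_pow 2 x).const_mul (-(1 / 2 : ℝ))).div_const ε).exp).const_mul
      (1 / Real.sqrt (2 * Real.pi * ε))
    refine HasDerivAt.congr_deriv (f := gaussKernel ε) this ?_
    simp
  rw [h.deriv, gaussKernel]; ring

/-- Fourier inversion for f_ε'. It linearizes the dependence on x in the exponent, so that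
expectations of products become characteristic functions. -/
theorem ofReal_deriv_gaussKernel {ε : ℝ} (hε : 0 < ε) (x : ℝ) :
    ((deriv (gaussKernel ε) x : ℝ) : ℂ) = (Complex.I / (2 * Real.pi)) *
      ∫ p : ℝ, (p : ℂ) * Complex.exp (-(ε / 2) * p ^ 2 + Complex.I * x * p) := by
  rw [integral_mul_cexp_neg_half_mul_sq_add hε, deriv_gaussKernel, gaussKernel]
  have hεc : (ε : ℂ) ≠ 0 := by exact_mod_cast hε.ne'
  have e1 : Complex.exp ((Complex.I * x) ^ 2 / (2 * ε)) =
      ((Real.exp (-(1 / 2) * x ^ 2 / ε) : ℝ) : ℂ) := by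
    rw [mul_pow, Complex.I_sq]; push_cast; congr 1; field_simp
  have e2 : √(2 * Real.pi / ε) = 2 * Real.pi * (1 / √(2 * Real.pi * ε)) := by
    have hs : √(2 * Real.pi * ε) = √(2 * Real.pi / ε) * ε := by
      rw [← Real.sqrt_sq hε.le, ← Real.sqrt_mul (by positivity), Real.sqrt_sq hε.le]
      congr 1; field_simp
    have h2 : √(2 * Real.pi / ε) * √(2 * Real.pi / ε) = 2 * Real.pi / ε :=
      Real.mul_self_sqrt (by positivity)
    have h3 : 0 < √(2 * Real.pi / ε) := by positivity
    rw [hs]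
    field_simp
    field_simp at h2
    linarith
  have hpi : (Real.pi : ℂ) ≠ 0 := by exact_mod_cast Real.pi_ne_zero
  rw [e1, e2]
  generalize Real.exp (-(1 / 2) * x ^ 2 / ε) = E
  generalize 1 / √(2 * Real.pi * ε) = S
  push_cast
  have : Complex.I / (2 * Real.pi) * (Complex.I * x / ε * (2 * Real.pi * S * E)) =
      Complex.I ^ 2 * (x / ε * (S * E)) := by
    field_simp
  rw [this, Complex.I_sq]
  ring

/-- The covariance of `f_ε'(X)` and `f_η'(Y)` for a centered Gaussian vector `(X, Y)`. -/
theorem integral_deriv_gaussKernel_mul {Ω : Type*} [MeasurableSpace Ω] {P : Measure Ω}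
    [IsProbabilityMeasure P] {X Y : Ω → ℝ} (hX : Measurable X) (hY : Measurable Y)
    {lam rho mu ε η : ℝ} (hε : 0 < ε) (hη : 0 < η) (hlam : 0 ≤ lam) (hrho : 0 ≤ rho)
    (hdet : mu ^ 2 ≤ lam * rho)
    (hchar : ∀ p q : ℝ, ∫ ω, Complex.exp (Complex.I * (p * X ω + q * Y ω)) ∂P =
      Complex.exp (-(lam * p ^ 2 + 2 * mu * p * q + rho * q ^ 2) / 2)) :
    ∫ ω, deriv (gaussKernel ε) (X ω) * deriv (gaussKernel η) (Y ω) ∂P =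
      mu / (2 * Real.pi * ((lam + ε) * (rho + η) - mu ^ 2) ^ (3 / 2 : ℝ)) := by
  set v := rho + η with hv
  set A := lam + ε with hA
  have hv0 : 0 < v := by positivity
  have hA0 : 0 < A := by positivity
  -- The Schur complement: integrating out q leaves a Gaussian in p with this inverse variance, and
  -- B v is the determinant.
  set B := A - mu ^ 2 / v with hB
  have hΔ : 0 < A * v - mu ^ 2 := by
    nlinarith [mul_nonneg hlam hη.le, mul_nonneg hrho hε.le, mul_pos hε hη]
  have hBv : B * v = A * v - mu ^ 2 := by rw [hB]; field_simp
  have hB0 : 0 < B := by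
    by_contra hcon
    nlinarith [mul_nonneg (by linarith : 0 ≤ -B) hv0.le]
  have hvc : (v : ℂ) ≠ 0 := by exact_mod_cast hv0.ne'
  have hint : Integrable (fun x : Ω × (ℝ × ℝ) ↦
      ((x.2.1 : ℂ) * Complex.exp (-(ε / 2) * x.2.1 ^ 2 + Complex.I * X x.1 * x.2.1)) *
      ((x.2.2 : ℂ) * Complex.exp (-(η / 2) * x.2.2 ^ 2 + Complex.I * Y x.1 * x.2.2)))
      (P.prod (volume.prod volume)) := by
    have i := ((integrable_mul_cexp_neg_half_mul_sq_add hε 0).mul_prod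
      (integrable_mul_cexp_neg_half_mul_sq_add hη 0)).comp_snd P
    refine i.mono (by fun_prop) (ae_of_all _ fun x ↦ le_of_eq ?_)
    have hn : ∀ a p w : ℝ, ‖Complex.exp (-(a / 2) * p ^ 2 + Complex.I * w * p)‖ =
        ‖Complex.exp (-(a / 2) * p ^ 2 + 0 * p)‖ := by
      intro a p w
      rw [Complex.norm_exp, Complex.norm_exp, Complex.add_re, Complex.add_re]
      simp
    simp only [norm_mul, hn]
  have hz : ∀ z : ℝ × ℝ, ∫ ω,
      ((z.1 : ℂ) * Complex.exp (-(ε / 2) * z.1 ^ 2 + Complex.I * X ω * z.1)) *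
      ((z.2 : ℂ) * Complex.exp (-(η / 2) * z.2 ^ 2 + Complex.I * Y ω * z.2)) ∂P =
      (z.1 * Complex.exp (-(A / 2) * z.1 ^ 2)) *
        (z.2 * Complex.exp (-(v / 2) * z.2 ^ 2 + -(mu * z.1) * z.2)) := by
    intro z
    have e : ∀ ω, ((z.1 : ℂ) * Complex.exp (-(ε / 2) * z.1 ^ 2 + Complex.I * X ω * z.1)) *
      ((z.2 : ℂ) * Complex.exp (-(η / 2) * z.2 ^ 2 + Complex.I * Y ω * z.2)) =
      (z.1 * z.2 * Complex.exp (-(ε / 2) * z.1 ^ 2 + -(η / 2) * z.2 ^ 2)) *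
        Complex.exp (Complex.I * (z.1 * X ω + z.2 * Y ω)) := by
      intro ω
      rw [mul_mul_mul_comm, ← Complex.exp_add, mul_assoc (z.1 * z.2 : ℂ) (Complex.exp _),
        ← Complex.exp_add]
      congr 2; ring
    simp_rw [e]
    rw [integral_const_mul, hchar, mul_mul_mul_comm, ← Complex.exp_add, 
      mul_assoc (z.1 * z.2 : ℂ) (Complex.exp _), ← Complex.exp_add]
    congr 2
    rw [hA, hv]; push_cast; ring
  have hint2 : Integrable (fun z : ℝ × ℝ ↦ ((z.1 : ℂ) * Complex.exp (-(A / 2) * z.1 ^ 2)) *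
        (z.2 * Complex.exp (-(v / 2) * z.2 ^ 2 + -(mu * z.1) * z.2))) (volume.prod volume) := by
    have := hint.integral_prod_right
    simpa only [hz] using this
  have hp : ∀ p : ℝ, ∫ q : ℝ, ((p : ℂ) * Complex.exp (-(A / 2) * p ^ 2)) *
      (q * Complex.exp (-(v / 2) * q ^ 2 + -(mu * p) * q)) =
      -(mu / v) * (√(2 * Real.pi / v) : ℝ) * (p ^ 2 * Complex.exp (-(B / 2) * p ^ 2)) := by
    intro p
    rw [integral_const_mul, integral_mul_cexp_neg_half_mul_sq_add hv0]
    have : Complex.exp (-(B / 2) * p ^ 2) = Complex.exp (-(A / 2) * p ^ 2) *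
        Complex.exp ((-(mu * p)) ^ 2 / (2 * v)) := by
      rw [← Complex.exp_add, hB]; congr 1; push_cast; field_simp; ring
    rw [this]; ring
  have main : ((∫ ω, deriv (gaussKernel ε) (X ω) * deriv (gaussKernel η) (Y ω) ∂P : ℝ) : ℂ) =
      (Complex.I / (2 * Real.pi)) ^ 2 * (-(mu / v) * (√(2 * Real.pi / v) : ℝ) *
        ((1 / B * √(2 * Real.pi / B) : ℝ) : ℂ)) := by
    rw [← integral_complex_ofReal]
    push_cast
    simp_rw [ofReal_deriv_gaussKernel hε, ofReal_deriv_gaussKernel hη, mul_mul_mul_comm,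
      ← sq, ← integral_prod_mul]
    rw [integral_const_mul, integral_integral_swap hint]
    simp_rw [hz]
    rw [integral_prod _ hint2]
    simp_rw [hp]
    rw [integral_const_mul, integral_sq_mul_cexp_neg_half_mul_sq hB0]
    push_cast; ring
  have hs : √(2 * Real.pi / v) * √(2 * Real.pi / B) = 2 * Real.pi / √(A * v - mu ^ 2) := by
    rw [← Real.sqrt_mul (by positivity), ← hBv, show 2 * Real.pi / v * (2 * Real.pi / B) =
      (2 * Real.pi) ^ 2 / (B * v) by field_simp, Real.sqrt_div (by positivity),
      Real.sqrt_sq (by positivity)]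
  have hpow : (A * v - mu ^ 2) ^ (3 / 2 : ℝ) = (A * v - mu ^ 2) * √(A * v - mu ^ 2) := by
    rw [Real.sqrt_eq_rpow, ← Real.rpow_one_add' hΔ.le (by norm_num)]; norm_num
  have hreal : (Complex.I / (2 * Real.pi)) ^ 2 * (-(mu / v) * (√(2 * Real.pi / v) : ℝ) *
        ((1 / B * √(2 * Real.pi / B) : ℝ) : ℂ)) =
      ((1 / (2 * Real.pi) ^ 2 * (mu / (B * v)) * (√(2 * Real.pi / v) * √(2 * Real.pi / B)) : ℝ) :
        ℂ) := by
    rw [div_pow, Complex.I_sq]; push_cast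
    ring
  rw [hreal] at main
  rw [Complex.ofReal_injective main, hs, hpow, hBv]
  have : 0 < √(A * v - mu ^ 2) := Real.sqrt_pos.2 hΔ
  have hpi := Real.pi_pos
  field_simp

/-! ### Joint law of two increments and regular versions of the process -/

theorem ProbabilityTheory.HasGaussianLaw.integral_cexp_I_mul {Ω : Type*} [MeasurableSpace Ω]
    {P : Measure Ω} {Z : Ω → ℝ} (hZ : HasGaussianLaw Z P) (hmean : ∫ ω, Z ω ∂P = 0) :
    ∫ ω, Complex.exp (Complex.I * Z ω) ∂P =
      Complex.exp (-((∫ ω, Z ω ^ 2 ∂P : ℝ) : ℂ) / 2) := by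
  have h := charFun_gaussianReal (μ := ∫ ω, Z ω ∂P) (v := (Var[Z; P]).toNNReal) 1
  rw [← hZ.map_eq_gaussianReal, charFun_apply_real, integral_map hZ.aemeasurable (by fun_prop),
    hmean, Real.coe_toNNReal _ (variance_nonneg _ _),
    variance_of_integral_eq_zero hZ.aemeasurable hmean] at h
  convert h using 1
  · congr 1; ext ω; congr 1; push_cast; ring
  · congr 1; push_cast; ring

namespace IsFractionalBrownianMotion

variable {Ω : Type*} [MeasurableSpace Ω] {P : Measure Ω} {H : ℝ} {B : ℝ≥0 → Ω → ℝ}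

theorem integral_cexp_incr (hB : IsFractionalBrownianMotion H B P) (hH : 0 < H)
    (s r s' r' : ℝ≥0) (p q : ℝ) :
    ∫ ω, Complex.exp (Complex.I * (p * ((B s ω - B r ω : ℝ) : ℂ) +
        q * ((B s' ω - B r' ω : ℝ) : ℂ))) ∂P =
      Complex.exp (-(((|(s : ℝ) - r| ^ (2 * H) : ℝ) : ℂ) * p ^ 2 +
        2 * (incrCov H s r s' r' : ℝ) * p * q +
        ((|(s' : ℝ) - r'| ^ (2 * H) : ℝ) : ℂ) * q ^ 2) / 2) := by
  set t : Fin 4 → ℝ≥0 := ![s, r, s', r'] with ht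
  set c : Fin 4 → ℝ := ![p, -p, q, -q] with hc
  have hG : HasGaussianLaw (fun ω ↦ ∑ i, c i * B (t i) ω) P :=
    ((hB.isGaussianProcess.comp_right t).smul c).hasGaussianLaw_fun_sum
  have hL2 : ∀ i, MemLp (B (t i)) 2 P := fun i ↦
    (hB.isGaussianProcess.hasGaussianLaw_eval (t i)).memLp_two
  have hi : ∀ i, Integrable (B (t i)) P := fun i ↦
    (hB.isGaussianProcess.hasGaussianLaw_eval (t i)).integrable
  have hmean : ∫ ω, ∑ i, c i * B (t i) ω ∂P = 0 := by
    rw [integral_finsetSum _ fun i _ ↦ (hi i).const_mul _]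
    simp [integral_const_mul, hB.integral_eq_zero]
  have h2H : 2 * H ≠ 0 := by positivity
  have hsq : ∫ ω, (∑ i, c i * B (t i) ω) ^ 2 ∂P = |(s : ℝ) - r| ^ (2 * H) * p ^ 2 +
      2 * incrCov H s r s' r' * p * q + |(s' : ℝ) - r'| ^ (2 * H) * q ^ 2 := by
    have e : ∀ ω, (∑ i, c i * B (t i) ω) ^ 2 =
        ∑ i, ∑ j, (c i * c j) * (B (t j) ω * B (t i) ω) := by
      intro ω
      rw [sq, Finset.sum_mul_sum]
      exact Finset.sum_congr rfl fun i _ ↦ Finset.sum_congr rfl fun j _ ↦ by ring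
    have hij : ∀ i j, Integrable (fun ω ↦ (c i * c j) * (B (t j) ω * B (t i) ω)) P := fun i j ↦
      ((hL2 j).integrable_mul (hL2 i)).const_mul _
    simp_rw [e]
    rw [integral_finsetSum _ fun i _ ↦ integrable_finsetSum _ fun j _ ↦ hij i j]
    simp_rw [integral_finsetSum Finset.univ fun j _ ↦ hij _ j, integral_const_mul,
      hB.integral_mul_eq]
    simp only [Fin.sum_univ_four, ht, hc, Matrix.cons_val_zero, Matrix.cons_val_one,
      Matrix.cons_val_two, Matrix.cons_val_three, Matrix.tail_cons, Matrix.head_cons, sub_self,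
      abs_zero, Real.zero_rpow h2H, incrCov, abs_sub_comm (r : ℝ) s, abs_sub_comm (s' : ℝ) s,
      abs_sub_comm (r' : ℝ) s, abs_sub_comm (s' : ℝ) r, abs_sub_comm (r' : ℝ) r,
      abs_sub_comm (r' : ℝ) s']
    ring
  have h := hG.integral_cexp_I_mul hmean
  rw [hsq] at h
  convert h using 1
  · congr 1; ext ω; congr 1
    simp only [Fin.sum_univ_four, ht, hc, Matrix.cons_val_zero, Matrix.cons_val_one,
      Matrix.cons_val_two, Matrix.cons_val_three, Matrix.tail_cons, Matrix.head_cons]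
    push_cast; ring
  · push_cast; rfl

/-- Fubini needs joint measurability in (t, ω), which follows from measurable marginals and
continuity of every path. Setting B to zero on a measurable null set gives continuity; measurability
is then checked on a dense sequence of times and extended by limits. -/
theorem exists_modification (hB : IsFractionalBrownianMotion H B P) :
    ∃ B' : ℝ≥0 → Ω → ℝ, IsFractionalBrownianMotion H B' P ∧ (∀ t, Measurable (B' t)) ∧
      (∀ ω, Continuous fun t ↦ B' t ω) ∧ ∀ᵐ ω ∂P, ∀ t, B t ω = B' t ω := by
  have hm := hB.isGaussianProcess.aemeasurable
  set d := TopologicalSpace.denseSeq ℝ≥0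
  have hgood : ∀ᵐ ω ∂P, Continuous (fun t : ℝ≥0 ↦ B t ω) ∧
      ∀ n, B (d n) ω = (hm (d n)).mk _ ω :=
    hB.continuous_paths.and (ae_all_iff.2 fun n ↦ (hm (d n)).ae_eq_mk)
  set N := toMeasurable P {ω | ¬ (Continuous (fun t : ℝ≥0 ↦ B t ω) ∧
      ∀ n, B (d n) ω = (hm (d n)).mk _ ω)} with hN
  have hN0 : P N = 0 := by rw [hN, measure_toMeasurable]; exact hgood
  have hNm : MeasurableSet N := measurableSet_toMeasurable _ _
  have hNgood : ∀ ω, ω ∉ N → Continuous (fun t : ℝ≥0 ↦ B t ω) ∧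
      ∀ n, B (d n) ω = (hm (d n)).mk _ ω := by
    intro ω hω
    by_contra hcon
    exact hω (subset_toMeasurable _ _ hcon)
  set B' : ℝ≥0 → Ω → ℝ := fun t ↦ Nᶜ.indicator (B t) with hB'
  have hcont : ∀ ω, Continuous fun t ↦ B' t ω := by
    intro ω
    by_cases hω : ω ∈ N
    · simp only [hB', Set.indicator_of_notMem (show ω ∉ Nᶜ from fun h ↦ h hω)]
      exact continuous_const
    · simp only [hB', Set.indicator_of_mem (show ω ∈ Nᶜ from hω)]
      exact (hNgood ω hω).1
  have hae : ∀ᵐ ω ∂P, ∀ t, B t ω = B' t ω := by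
    filter_upwards [measure_eq_zero_iff_ae_notMem.1 hN0] with ω hω t
    simp only [hB', Set.indicator_of_mem (show ω ∈ Nᶜ from hω)]
  have hmd : ∀ n, Measurable (B' (d n)) := by
    intro n
    have : B' (d n) = Nᶜ.indicator ((hm (d n)).mk _) := by
      ext ω
      by_cases hω : ω ∈ N
      · simp [hB', hω]
      · simp [hB', hω, (hNgood ω hω).2 n]
    rw [this]
    exact (hm (d n)).measurable_mk.indicator hNm.compl
  have hmeas : ∀ t, Measurable (B' t) := by
    intro t
    obtain ⟨x, hx, hxt⟩ := mem_closure_iff_seq_limit.1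
      ((TopologicalSpace.denseRange_denseSeq ℝ≥0) t)
    refine measurable_of_tendsto_metrizable (f := fun n ↦ B' (x n)) (fun n ↦ ?_)
      (tendsto_pi_nhds.2 fun ω ↦ ((hcont ω).tendsto t).comp hxt)
    obtain ⟨k, hk⟩ := hx n
    rw [← hk]; exact hmd k
  have haet : ∀ t, B t =ᵐ[P] B' t := fun t ↦ hae.mono fun ω h ↦ h t
  refine ⟨B', ⟨hB.isGaussianProcess.congr haet, fun t ↦ ?_, fun s t ↦ ?_, ae_of_all _ hcont⟩,
    hmeas, hcont, hae⟩
  · rw [← hB.integral_eq_zero t]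
    exact integral_congr_ae (haet t).symm
  · rw [← hB.integral_mul_eq s t]
    exact integral_congr_ae ((haet t).symm.mul (haet s).symm)

end IsFractionalBrownianMotion

/-! ### The approximation as an integral over a box -/

theorem dsltApprox_congr {Ω : Type*} {H : ℝ} {B B' : ℝ≥0 → Ω → ℝ} {ω : Ω}
    (h : ∀ t, B t ω = B' t ω) (y ε : ℝ) (t : ℝ≥0) :
    dsltApprox H B y ε t ω = dsltApprox H B' y ε t ω := by
  simp only [dsltApprox, h]

theorem continuous_deriv_gaussKernel (ε : ℝ) : Continuous (deriv (gaussKernel ε)) := by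
  rw [funext (deriv_gaussKernel (ε := ε))]
  unfold gaussKernel
  fun_prop

theorem exists_abs_deriv_gaussKernel_le {ε : ℝ} (hε : 0 < ε) :
    ∃ K : ℝ, 0 ≤ K ∧ ∀ x, |deriv (gaussKernel ε) x| ≤ K := by
  refine ⟨1 / √(2 * Real.pi * ε) * ((1 + 2 * ε) / ε), by positivity, fun x ↦ ?_⟩
  rw [deriv_gaussKernel, gaussKernel, abs_mul, abs_neg, abs_div, abs_of_pos hε,
    abs_of_nonneg (by positivity : 0 ≤ 1 / √(2 * Real.pi * ε) * Real.exp (-(1 / 2) * x ^ 2 / ε))]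
  set y := x ^ 2 / (2 * ε) with hy
  have hy0 : 0 ≤ y := by positivity
  have e : -(1 / 2) * x ^ 2 / ε = -y := by rw [hy]; field_simp
  have hx : x ^ 2 = 2 * ε * y := by rw [hy]; field_simp
  have h1 : |x| ≤ (1 + 2 * ε) * (1 + y) := by
    have : |x| ≤ 1 + x ^ 2 := by nlinarith [sq_nonneg (|x| - 1), sq_abs x, abs_nonneg x]
    nlinarith [mul_nonneg hε.le hy0]
  have h2 : (1 + y) * Real.exp (-y) ≤ 1 := by
    rw [Real.exp_neg, ← div_eq_mul_inv, div_le_one (Real.exp_pos _)]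
    linarith [Real.add_one_le_exp y]
  have h3 : |x| * Real.exp (-y) ≤ 1 + 2 * ε := by
    calc |x| * Real.exp (-y) ≤ (1 + 2 * ε) * (1 + y) * Real.exp (-y) := by gcongr
      _ = (1 + 2 * ε) * ((1 + y) * Real.exp (-y)) := by ring
      _ ≤ (1 + 2 * ε) * 1 := by gcongr
      _ = _ := mul_one _
  rw [e]
  calc |x| / ε * (1 / √(2 * Real.pi * ε) * Real.exp (-y)) =
        1 / √(2 * Real.pi * ε) * (|x| * Real.exp (-y) / ε) := by ring
    _ ≤ _ := by gcongr

/-- The weight `(s - r) ^ (2H - 1)` on `{r < s}`. -/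
noncomputable def incrWeight (H : ℝ) (z : ℝ × ℝ) : ℝ :=
  if z.2 < z.1 then (z.1 - z.2) ^ (2 * H - 1) else 0

theorem incrWeight_nonneg (H : ℝ) (z : ℝ × ℝ) : 0 ≤ incrWeight H z := by
  unfold incrWeight
  split_ifs with h
  · exact Real.rpow_nonneg (by linarith) _
  · exact le_rfl

theorem measurable_incrWeight (H : ℝ) : Measurable (incrWeight H) := by
  unfold incrWeight
  exact Measurable.ite (measurableSet_lt measurable_snd measurable_fst) (by fun_prop) (by fun_prop)

instance (a b T : ℝ) : IsFiniteMeasure (boxMeasure a b T) := by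
  unfold boxMeasure; infer_instance

theorem ae_mem_boxMeasure (a b T : ℝ) :
    ∀ᵐ z ∂boxMeasure a b T, z ∈ Set.Ioc a b ×ˢ Set.Ioc 0 T := by
  rw [boxMeasure, Measure.prod_restrict]
  exact ae_restrict_mem (measurableSet_Ioc.prod measurableSet_Ioc)

/-- The exponent 2H - 1 exceeds -1. As f_ε' is bounded for fixed ε, this controls the approximations
pathwise and makes them bounded random variables. -/
theorem integrable_incrWeight {H a b T : ℝ} (hH : 0 < H) (ha : 0 ≤ a) (hb : b ≤ T) :
    Integrable (incrWeight H) (boxMeasure a b T) := by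
  have hm := measurable_incrWeight H
  refine ⟨hm.aestronglyMeasurable, ?_⟩
  rw [hasFiniteIntegral_iff_ofReal (ae_of_all _ (incrWeight_nonneg H)), boxMeasure,
    lintegral_prod _ (by fun_prop)]
  have hle : ∀ z : ℝ × ℝ, ENNReal.ofReal (incrWeight H z) ≤ singWeight (1 - 2 * H) (z.1 - z.2) := by
    intro z
    unfold incrWeight
    split_ifs with h
    · have h' : 0 < z.1 - z.2 := by linarith
      rw [singWeight_of_ne_zero _ h'.ne', abs_of_pos h', neg_sub]
    · simp
  calc _ ≤ ∫⁻ _ in Set.Ioc a b, ENNReal.ofReal (2 / (1 - (1 - 2 * H)) *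
        (T - 0) ^ (1 - (1 - 2 * H))) := by
        refine lintegral_mono_ae ?_
        filter_upwards [ae_restrict_mem measurableSet_Ioc] with s hs
        refine (lintegral_mono fun r ↦ hle (s, r)).trans ?_
        exact setLIntegral_singWeight_le (by linarith) ⟨by linarith [hs.1], by linarith [hs.2]⟩
    _ < ∞ := by
        rw [lintegral_const]
        exact ENNReal.mul_lt_top ENNReal.ofReal_lt_top (measure_lt_top _ _)

/-- The integrand of `dsltApprox` at level zero, extended by zero outside `{r < s}`. -/
noncomputable def dsltIntegrand {Ω : Type*} (H : ℝ) (B : ℝ≥0 → Ω → ℝ) (ε : ℝ) (ω : Ω)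
    (z : ℝ × ℝ) : ℝ :=
  incrWeight H z * deriv (gaussKernel ε) (B z.1.toNNReal ω - B z.2.toNNReal ω)

theorem dsltApprox_zero {Ω : Type*} {H : ℝ} {B : ℝ≥0 → Ω → ℝ} (y ε : ℝ) (ω : Ω) :
    dsltApprox H B y ε 0 ω = 0 := by
  simp [dsltApprox]

section

variable {Ω : Type*} [MeasurableSpace Ω] {P : Measure Ω} {H : ℝ} {B : ℝ≥0 → Ω → ℝ}

theorem measurable_dsltIntegrand (hBm : ∀ t, Measurable (B t))
    (hBc : ∀ ω, Continuous fun t ↦ B t ω) (ε : ℝ) :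
    Measurable fun x : Ω × (ℝ × ℝ) ↦ dsltIntegrand H B ε x.1 x.2 := by
  have hu : Measurable (Function.uncurry B) :=
    measurable_uncurry_of_continuous_of_measurable hBc hBm
  have hw := measurable_incrWeight H
  have hd := (continuous_deriv_gaussKernel ε).measurable
  have h1 : Measurable fun x : Ω × (ℝ × ℝ) ↦ B x.2.1.toNNReal x.1 :=
    hu.comp (by fun_prop : Measurable fun x : Ω × (ℝ × ℝ) ↦ (x.2.1.toNNReal, x.1))
  have h2 : Measurable fun x : Ω × (ℝ × ℝ) ↦ B x.2.2.toNNReal x.1 :=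
    hu.comp (by fun_prop : Measurable fun x : Ω × (ℝ × ℝ) ↦ (x.2.2.toNNReal, x.1))
  exact (hw.comp measurable_snd).mul (hd.comp (h1.sub h2))

theorem integrable_dsltIntegrand (hH : 0 < H) (hBm : ∀ t, Measurable (B t))
    (hBc : ∀ ω, Continuous fun t ↦ B t ω) {ε : ℝ} (hε : 0 < ε) (ω : Ω) {a b T : ℝ} (ha : 0 ≤ a)
    (hb : b ≤ T) : Integrable (dsltIntegrand H B ε ω) (boxMeasure a b T) := by
  obtain ⟨K, hK, hbd⟩ := exists_abs_deriv_gaussKernel_le hε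
  refine Integrable.mono' ((integrable_incrWeight hH ha hb).mul_const K)
    ((measurable_dsltIntegrand hBm hBc ε).comp measurable_prodMk_left).aestronglyMeasurable
    (ae_of_all _ fun z ↦ ?_)
  rw [dsltIntegrand, Real.norm_eq_abs, abs_mul, abs_of_nonneg (incrWeight_nonneg H z)]
  exact mul_le_mul_of_nonneg_left (hbd _) (incrWeight_nonneg H z)

theorem integral_boxMeasure_dsltIntegrand (hH : 0 < H) (hBm : ∀ t, Measurable (B t))
    (hBc : ∀ ω, Continuous fun t ↦ B t ω) {ε : ℝ} (hε : 0 < ε) (ω : Ω) {a b T : ℝ} (ha : 0 ≤ a)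
    (hab : a ≤ b) (hb : b ≤ T) :
    ∫ z, dsltIntegrand H B ε ω z ∂boxMeasure a b T =
      ∫ s in a..b, ∫ r in (0 : ℝ)..s,
        deriv (gaussKernel ε) (B s.toNNReal ω - B r.toNNReal ω - 0) * (s - r) ^ (2 * H - 1) := by
  have hi := integrable_dsltIntegrand hH hBm hBc hε ω ha hb
  rw [boxMeasure] at hi ⊢
  rw [integral_prod _ hi, intervalIntegral.integral_of_le hab]
  refine setIntegral_congr_fun measurableSet_Ioc fun s hs ↦ ?_
  have hs0 : 0 ≤ s := by linarith [hs.1]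
  have hsT : s ≤ T := by linarith [hs.2]
  rw [intervalIntegral.integral_of_le hs0]
  have e : ∀ r, dsltIntegrand H B ε ω (s, r) = (Set.Iio s).indicator (fun r ↦
      deriv (gaussKernel ε) (B s.toNNReal ω - B r.toNNReal ω - 0) * (s - r) ^ (2 * H - 1)) r := by
    intro r
    simp only [dsltIntegrand, incrWeight, Set.indicator, Set.mem_Iio, sub_zero]
    split_ifs <;> ring
  simp_rw [e]
  rw [setIntegral_indicator measurableSet_Iio, integral_Ioc_eq_integral_Ioo]
  congr 2
  ext r
  simp only [Set.mem_inter_iff, Set.mem_Ioc, Set.mem_Iio, Set.mem_Ioo]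
  constructor
  · rintro ⟨⟨h1, h2⟩, h3⟩; exact ⟨h1, h3⟩
  · rintro ⟨h1, h2⟩; exact ⟨⟨h1, by linarith⟩, h2⟩

theorem dsltApprox_sub_dsltApprox (hH : 0 < H) (hBm : ∀ t, Measurable (B t))
    (hBc : ∀ ω, Continuous fun t ↦ B t ω) {ε : ℝ} (hε : 0 < ε) (ω : Ω) {a b : ℝ≥0} {T : ℝ}
    (hab : a ≤ b) (hb : b ≤ T) :
    dsltApprox H B 0 ε b ω - dsltApprox H B 0 ε a ω =
      -∫ z, dsltIntegrand H B ε ω z ∂boxMeasure a b T := by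
  have h := fun (c d : ℝ) (hc : 0 ≤ c) hcd hd ↦
    integral_boxMeasure_dsltIntegrand (a := c) (b := d) (T := T) hH hBm hBc hε ω hc hcd hd
  have hab' : (a : ℝ) ≤ b := hab
  have hbox : ∫ z, dsltIntegrand H B ε ω z ∂boxMeasure 0 b T =
      ∫ z, dsltIntegrand H B ε ω z ∂boxMeasure 0 a T +
        ∫ z, dsltIntegrand H B ε ω z ∂boxMeasure a b T := by
    have hsum : boxMeasure 0 b T = boxMeasure 0 a T + boxMeasure a b T := by
      unfold boxMeasure
      rw [← Measure.add_prod, ← Measure.restrict_union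
        (Set.Ioc_disjoint_Ioc_of_le le_rfl) measurableSet_Ioc,
        Set.Ioc_union_Ioc_eq_Ioc a.coe_nonneg hab']
    rw [hsum, integral_add_measure (integrable_dsltIntegrand hH hBm hBc hε ω le_rfl
      (hab'.trans hb)) (integrable_dsltIntegrand hH hBm hBc hε ω a.coe_nonneg hb)]
  rw [dsltApprox, dsltApprox, ← h 0 b le_rfl b.coe_nonneg hb,
    ← h 0 a le_rfl a.coe_nonneg (hab'.trans hb), hbox]
  ring

end

/-! ### Second moments and the L² limit -/

/-- The covariance of the integrands of `dsltApprox` at `z.1` and `z.2`. -/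
noncomputable def momentKernel (H ε η : ℝ) (z : (ℝ × ℝ) × (ℝ × ℝ)) : ℝ :=
  incrWeight H z.1 * incrWeight H z.2 * (incrCov H z.1.1 z.1.2 z.2.1 z.2.2 /
    (2 * Real.pi * ((|z.1.1 - z.1.2| ^ (2 * H) + ε) * (|z.2.1 - z.2.2| ^ (2 * H) + η) -
      incrCov H z.1.1 z.1.2 z.2.1 z.2.2 ^ 2) ^ (3 / 2 : ℝ)))

theorem measurable_momentKernel (H ε η : ℝ) : Measurable (momentKernel H ε η) := by
  have hw := measurable_incrWeight H
  unfold momentKernel incrCov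
  fun_prop

theorem incrDet_add_pos {H s r s' r' ε η : ℝ} (h₀ : 0 < H) (h₁ : H < 1) (h1 : s ≠ r) (h2 : s ≠ s')
    (h3 : s ≠ r') (h4 : s' ≠ r') (hε : 0 ≤ ε) (hη : 0 ≤ η) :
    0 < (|s - r| ^ (2 * H) + ε) * (|s' - r'| ^ (2 * H) + η) - incrCov H s r s' r' ^ 2 := by
  have h := incrDet_pos h₀ h₁ h1 h2 h3 h4
  rw [incrDet] at h
  have i1 : 0 ≤ |s - r| ^ (2 * H) := by positivity
  have i2 : 0 ≤ |s' - r'| ^ (2 * H) := by positivity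
  nlinarith [mul_nonneg i1 hη, mul_nonneg i2 hε, mul_nonneg hε hη]

theorem exists_ofReal_abs_momentKernel_le {H p T : ℝ} (h₀ : 0 < H) (h₁ : H < 2 / 3) (hp1 : p < 1)
    (hp : 1 / 2 + 3 / 4 * H ≤ p) (hp' : 1 - H / 4 ≤ p) (hT : 1 ≤ T) :
    ∃ C : ℝ, 0 < C ∧ ∀ (ε η : ℝ) (z : (ℝ × ℝ) × (ℝ × ℝ)), 0 ≤ ε → 0 ≤ η → z.1.1 ≤ T → z.2.1 ≤ T →
      0 ≤ z.1.2 → 0 ≤ z.2.2 → ENNReal.ofReal |momentKernel H ε η z| ≤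
        ENNReal.ofReal C * domKernel p z.1.1 z.1.2 z.2.1 z.2.2 := by
  obtain ⟨C, hC, h⟩ := exists_ofReal_kernel_le h₀ h₁ hp1 hp hp' hT
  refine ⟨C, hC, fun ε η z hε hη h1 h2 h3 h4 ↦ ?_⟩
  by_cases hz1 : z.1.2 < z.1.1
  swap
  · simp [momentKernel, incrWeight, hz1]
  by_cases hz2 : z.2.2 < z.2.1
  swap
  · simp [momentKernel, incrWeight, hz2]
  by_cases hdeg : z.1.1 = z.2.1 ∨ z.1.2 = z.2.2 ∨ z.2.1 = z.1.2 ∨ z.1.1 = z.2.2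
  · rw [domKernel_eq_top (by linarith) hdeg, ENNReal.mul_top (by simpa using hC)]
    exact le_top
  push Not at hdeg
  obtain ⟨d1, d2, d3, d4⟩ := hdeg
  refine le_trans (ENNReal.ofReal_le_ofReal ?_) (h _ _ _ _ ε η h1 h2 h3 h4 hz1 hz2 hε hη)
  have hw1 : 0 < (z.1.1 - z.1.2) ^ (2 * H - 1) := Real.rpow_pos_of_pos (by linarith) _
  have hw2 : 0 < (z.2.1 - z.2.2) ^ (2 * H - 1) := Real.rpow_pos_of_pos (by linarith) _
  have hD := incrDet_add_pos h₀ (by linarith) hz1.ne' d1 d4 hz2.ne' hε hη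
  set D := (|z.1.1 - z.1.2| ^ (2 * H) + ε) * (|z.2.1 - z.2.2| ^ (2 * H) + η) -
    incrCov H z.1.1 z.1.2 z.2.1 z.2.2 ^ 2
  have hDp : 0 < D ^ (3 / 2 : ℝ) := Real.rpow_pos_of_pos hD _
  have hpi : 1 ≤ 2 * Real.pi := by linarith [Real.pi_gt_three]
  rw [momentKernel, incrWeight, incrWeight, if_pos hz1, if_pos hz2, abs_mul, abs_div,
    abs_of_pos (mul_pos hw1 hw2), abs_of_pos (by positivity : 0 < 2 * Real.pi * D ^ (3 / 2 : ℝ)),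
    mul_div_assoc]
  gcongr
  nlinarith

section

variable {Ω : Type*} [MeasurableSpace Ω] {P : Measure Ω} {H : ℝ} {B : ℝ≥0 → Ω → ℝ}

/-- Cauchy–Schwarz read off from the bound 1 on the modulus of the characteristic function: at (p,
q) = (-μ, λ) the covariance form takes the value λ(λρ - μ²). -/
theorem IsFractionalBrownianMotion.incrCov_sq_le [IsProbabilityMeasure P]
    (hB : IsFractionalBrownianMotion H B P)
    (hH : 0 < H) {s r : ℝ≥0} (hsr : s ≠ r) (s' r' : ℝ≥0) :
    incrCov H s r s' r' ^ 2 ≤ |(s : ℝ) - r| ^ (2 * H) * |(s' : ℝ) - r'| ^ (2 * H) := by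
  set m := incrCov H s r s' r' with hm
  set lam := |(s : ℝ) - r| ^ (2 * H) with hlam
  set rho := |(s' : ℝ) - r'| ^ (2 * H) with hrho
  have hlam0 : 0 < lam := Real.rpow_pos_of_pos (abs_pos.2 (sub_ne_zero.2
    (fun h ↦ hsr (NNReal.coe_injective h)))) _
  have h := hB.integral_cexp_incr hH s r s' r' (-m) lam
  have h1 : ‖Complex.exp (-((lam : ℂ) * ((-m : ℝ) : ℂ) ^ 2 + 2 * (m : ℂ) * ((-m : ℝ) : ℂ) * lam +
      (rho : ℂ) * lam ^ 2) / 2)‖ ≤ 1 := by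
    rw [← h]
    refine (norm_integral_le_of_norm_le_const (C := 1) (ae_of_all _ fun ω ↦ ?_)).trans (by simp)
    rw [mul_comm, ← Complex.ofReal_mul, ← Complex.ofReal_mul, ← Complex.ofReal_add,
      Complex.norm_exp_ofReal_mul_I]
  rw [show (-((lam : ℂ) * ((-m : ℝ) : ℂ) ^ 2 + 2 * (m : ℂ) * ((-m : ℝ) : ℂ) * lam +
      (rho : ℂ) * lam ^ 2) / 2) = ((-(lam * (lam * rho - m ^ 2)) / 2 : ℝ) : ℂ) by
    push_cast; ring, Complex.norm_exp_ofReal, Real.exp_le_one_iff] at h1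
  by_contra hcon
  push Not at hcon
  nlinarith [mul_pos hlam0 (sub_pos.2 hcon)]

theorem integral_mul_integral_dsltIntegrand [IsProbabilityMeasure P]
    (hB : IsFractionalBrownianMotion H B P)
    (hH : 0 < H) (hBm : ∀ t, Measurable (B t)) (hBc : ∀ ω, Continuous fun t ↦ B t ω) {ε η : ℝ}
    (hε : 0 < ε) (hη : 0 < η) {a b T : ℝ} (ha : 0 ≤ a) (hb : b ≤ T) :
    ∫ ω, (∫ z, dsltIntegrand H B ε ω z ∂boxMeasure a b T) *
      (∫ z, dsltIntegrand H B η ω z ∂boxMeasure a b T) ∂P =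
      ∫ z, momentKernel H ε η z ∂(boxMeasure a b T).prod (boxMeasure a b T) := by
  set ν := boxMeasure a b T
  have hw := integrable_incrWeight (T := T) hH ha hb
  obtain ⟨K, hK0, hK⟩ := exists_abs_deriv_gaussKernel_le hε
  obtain ⟨K', hK0', hK'⟩ := exists_abs_deriv_gaussKernel_le hη
  have hint : Integrable (fun x : Ω × ((ℝ × ℝ) × (ℝ × ℝ)) ↦
      dsltIntegrand H B ε x.1 x.2.1 * dsltIntegrand H B η x.1 x.2.2) (P.prod (ν.prod ν)) := by
    refine Integrable.mono' (((hw.mul_const K).mul_prod (hw.mul_const K')).comp_snd P) ?_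
      (ae_of_all _ fun x ↦ ?_)
    · exact (((measurable_dsltIntegrand hBm hBc ε).comp (by fun_prop :
        Measurable fun x : Ω × ((ℝ × ℝ) × (ℝ × ℝ)) ↦ (x.1, x.2.1))).mul
        ((measurable_dsltIntegrand hBm hBc η).comp (by fun_prop :
        Measurable fun x : Ω × ((ℝ × ℝ) × (ℝ × ℝ)) ↦ (x.1, x.2.2)))).aestronglyMeasurable
    · rw [norm_mul, dsltIntegrand, dsltIntegrand, norm_mul, norm_mul,
        Real.norm_of_nonneg (incrWeight_nonneg _ _), Real.norm_of_nonneg (incrWeight_nonneg _ _)]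
      exact mul_le_mul (mul_le_mul_of_nonneg_left (hK _) (incrWeight_nonneg _ _))
        (mul_le_mul_of_nonneg_left (hK' _) (incrWeight_nonneg _ _))
        (mul_nonneg (incrWeight_nonneg _ _) (norm_nonneg _))
        (mul_nonneg (incrWeight_nonneg _ _) hK0)
  simp_rw [← integral_prod_mul]
  rw [integral_integral_swap hint]
  have hmem : ∀ᵐ z ∂ν.prod ν, z.1 ∈ Set.Ioc a b ×ˢ Set.Ioc 0 T ∧
      z.2 ∈ Set.Ioc a b ×ˢ Set.Ioc 0 T :=
    (Measure.quasiMeasurePreserving_fst.ae (ae_mem_boxMeasure a b T)).and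
      (Measure.quasiMeasurePreserving_snd.ae (ae_mem_boxMeasure a b T))
  refine integral_congr_ae ?_
  filter_upwards [hmem] with z hz
  have e : ∀ ω, dsltIntegrand H B ε ω z.1 * dsltIntegrand H B η ω z.2 =
      incrWeight H z.1 * incrWeight H z.2 *
        (deriv (gaussKernel ε) (B z.1.1.toNNReal ω - B z.1.2.toNNReal ω) *
          deriv (gaussKernel η) (B z.2.1.toNNReal ω - B z.2.2.toNNReal ω)) := by
    intro ω; rw [dsltIntegrand, dsltIntegrand]; ring
  simp_rw [e]
  rw [integral_const_mul, momentKernel]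
  by_cases hz1 : z.1.2 < z.1.1
  swap
  · simp [incrWeight, hz1]
  congr 1
  obtain ⟨⟨⟨p1, -⟩, ⟨p2, -⟩⟩, ⟨⟨p3, -⟩, ⟨p4, -⟩⟩⟩ := hz
  have c1 : (z.1.1.toNNReal : ℝ) = z.1.1 := Real.coe_toNNReal _ (by linarith)
  have c2 : (z.1.2.toNNReal : ℝ) = z.1.2 := Real.coe_toNNReal _ p2.le
  have c3 : (z.2.1.toNNReal : ℝ) = z.2.1 := Real.coe_toNNReal _ (by linarith)
  have c4 : (z.2.2.toNNReal : ℝ) = z.2.2 := Real.coe_toNNReal _ p4.le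
  have hne : z.1.1.toNNReal ≠ z.1.2.toNNReal := by
    intro h
    rw [← c1, ← c2, h] at hz1
    exact lt_irrefl _ hz1
  have hcs := hB.incrCov_sq_le hH hne z.2.1.toNNReal z.2.2.toNNReal
  have hchar := hB.integral_cexp_incr hH z.1.1.toNNReal z.1.2.toNNReal z.2.1.toNNReal
    z.2.2.toNNReal
  rw [c1, c2, c3, c4] at hcs hchar
  exact integral_deriv_gaussKernel_mul ((hBm _).sub (hBm _)) ((hBm _).sub (hBm _)) hε hη
    (by positivity) (by positivity) hcs hchar

end

theorem MeasureTheory.MemLp.eLpNorm_two_eq_ofReal_sqrt {Ω : Type*} [MeasurableSpace Ω]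
    {P : Measure Ω} {f : Ω → ℝ} (hf : MemLp f 2 P) :
    eLpNorm f 2 P = ENNReal.ofReal √(∫ ω, f ω ^ 2 ∂P) := by
  rw [hf.eLpNorm_eq_integral_rpow_norm (by norm_num) (by norm_num), Real.sqrt_eq_rpow]
  simp

theorem exists_tendsto_eLpNorm_sub_of_cauchy {Ω : Type*} [MeasurableSpace Ω] {P : Measure Ω}
    {J : ℝ → Ω → ℝ} (hJ : ∀ ε, 0 < ε → MemLp (J ε) 2 P)
    (hc : Tendsto (fun q : ℝ × ℝ ↦ eLpNorm (J q.1 - J q.2) 2 P) (𝓝[>] 0 ×ˢ 𝓝[>] 0) (𝓝 0)) :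
    ∃ f : Ω → ℝ, MemLp f 2 P ∧
      Tendsto (fun ε : ℝ ↦ eLpNorm (J ε - f) 2 P) (𝓝[>] 0) (𝓝 0) := by
  have : Fact ((1 : ℝ≥0∞) ≤ 2) := ⟨by norm_num⟩
  have hpos : ∀ᶠ q : ℝ × ℝ in 𝓝[>] 0 ×ˢ 𝓝[>] 0, 0 < q.1 ∧ 0 < q.2 :=
    (eventually_mem_nhdsWithin (a := (0 : ℝ)) (s := Set.Ioi 0)).prod_mk eventually_mem_nhdsWithin
  let F : ℝ → Lp ℝ 2 P := fun ε ↦ if h : 0 < ε then (hJ ε h).toLp else 0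
  have hFe : ∀ ε (h : 0 < ε), F ε = (hJ ε h).toLp := fun ε h ↦ dif_pos h
  have hu : Tendsto (fun q : ℝ × ℝ ↦ (F q.1, F q.2)) (𝓝[>] 0 ×ˢ 𝓝[>] 0)
      (uniformity (Lp ℝ 2 P)) := by
    rw [tendsto_uniformity_iff_dist_tendsto_zero]
    have h := (ENNReal.tendsto_toReal ENNReal.zero_ne_top).comp hc
    rw [ENNReal.toReal_zero] at h
    refine h.congr' ?_
    filter_upwards [hpos] with q hq
    rw [Function.comp_apply, dist_edist, hFe _ hq.1, hFe _ hq.2, Lp.edist_toLp_toLp]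
  obtain ⟨f, hf⟩ := cauchy_map_iff_exists_tendsto.1 (cauchy_map_iff'.2 hu)
  refine ⟨f, Lp.memLp f, ?_⟩
  rw [Lp.tendsto_Lp_iff_tendsto_eLpNorm'] at hf
  refine hf.congr' ?_
  filter_upwards [eventually_mem_nhdsWithin (a := (0 : ℝ)) (s := Set.Ioi 0)] with ε hε
  rw [hFe ε hε]
  exact eLpNorm_congr_ae ((hJ ε hε).coeFn_toLp.sub (ae_eq_refl _))

/-- Expanding the square, a family is Cauchy in L² as soon as its mixed moments Φ(ε, η) have a joint
limit, because L - 2L + L = 0. -/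
theorem tendsto_zero_of_eq_ofReal_sqrt {f : ℝ → ℝ → ℝ≥0∞} {Φ : ℝ → ℝ → ℝ} {L : ℝ}
    (hlim : Tendsto (fun q : ℝ × ℝ ↦ Φ q.1 q.2) (𝓝[>] 0 ×ˢ 𝓝[>] 0) (𝓝 L))
    (hf : ∀ ε η, 0 < ε → 0 < η → f ε η = ENNReal.ofReal √(Φ ε ε - 2 * Φ ε η + Φ η η)) :
    Tendsto (fun q : ℝ × ℝ ↦ f q.1 q.2) (𝓝[>] 0 ×ˢ 𝓝[>] 0) (𝓝 0) := by
  have hpos : ∀ᶠ q : ℝ × ℝ in 𝓝[>] 0 ×ˢ 𝓝[>] 0, 0 < q.1 ∧ 0 < q.2 :=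
    (eventually_mem_nhdsWithin (a := (0 : ℝ)) (s := Set.Ioi 0)).prod_mk eventually_mem_nhdsWithin
  have h11 : Tendsto (fun q : ℝ × ℝ ↦ Φ q.1 q.1) (𝓝[>] 0 ×ˢ 𝓝[>] 0) (𝓝 L) :=
    Tendsto.comp (f := fun q : ℝ × ℝ ↦ (q.1, q.1)) hlim (tendsto_fst.prodMk tendsto_fst)
  have h22 : Tendsto (fun q : ℝ × ℝ ↦ Φ q.2 q.2) (𝓝[>] 0 ×ˢ 𝓝[>] 0) (𝓝 L) :=
    Tendsto.comp (f := fun q : ℝ × ℝ ↦ (q.2, q.2)) hlim (tendsto_snd.prodMk tendsto_snd)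
  have h := ENNReal.tendsto_ofReal (((h11.sub (hlim.const_mul 2)).add h22).sqrt)
  rw [show L - 2 * L + L = 0 by ring, Real.sqrt_zero, ENNReal.ofReal_zero] at h
  refine h.congr' ?_
  filter_upwards [hpos] with q hq using (hf q.1 q.2 hq.1 hq.2).symm

theorem ae_mem_boxMeasure_prod (a b T : ℝ) :
    ∀ᵐ z ∂(boxMeasure a b T).prod (boxMeasure a b T), z.1 ∈ Set.Ioc a b ×ˢ Set.Ioc 0 T ∧
      z.2 ∈ Set.Ioc a b ×ˢ Set.Ioc 0 T :=
  (Measure.quasiMeasurePreserving_fst.ae (ae_mem_boxMeasure a b T)).and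
    (Measure.quasiMeasurePreserving_snd.ae (ae_mem_boxMeasure a b T))

/-- One majorant serves all ε, η ≥ 0 and all boxes. Where it is finite, s differs from s' and r'; on
{r < s, r' < s'} this suffices for a positive determinant, hence for convergence of the kernel. -/
theorem exists_dominating_momentKernel {H p T : ℝ} (h₀ : 0 < H) (h₁ : H < 2 / 3) (hp1 : p < 1)
    (hp : 1 / 2 + 3 / 4 * H ≤ p) (hp' : 1 - H / 4 ≤ p) (hT : 1 ≤ T) :
    ∃ C : ℝ, 0 < C ∧ ∃ M : (ℝ × ℝ) × (ℝ × ℝ) → ℝ≥0∞, Measurable M ∧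
      (∀ z, M z ≠ ∞ → z.1.1 ≠ z.2.1 ∧ z.1.1 ≠ z.2.2) ∧
      ∀ a b : ℝ, 0 ≤ a → a ≤ b → b ≤ T →
        (∫⁻ z, M z ∂(boxMeasure a b T).prod (boxMeasure a b T) ≤
          ENNReal.ofReal (C * (b - a) ^ (2 - p))) ∧
        ∀ ε η : ℝ, 0 ≤ ε → 0 ≤ η → ∀ᵐ z ∂(boxMeasure a b T).prod (boxMeasure a b T),
          ENNReal.ofReal |momentKernel H ε η z| ≤ M z := by
  obtain ⟨C₁, hC₁, h1⟩ := exists_ofReal_abs_momentKernel_le h₀ h₁ hp1 hp hp' hT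
  obtain ⟨C₂, hC₂, h2⟩ := exists_lintegral_domKernel_le hp1 T
  have hm := measurable_domKernel p
  refine ⟨C₁ * C₂, by positivity,
    fun z ↦ ENNReal.ofReal C₁ * domKernel p z.1.1 z.1.2 z.2.1 z.2.2, by fun_prop, ?_, ?_⟩
  · intro z hz
    constructor
    · intro h
      refine hz ?_
      simp only
      rw [domKernel_eq_top (by linarith) (Or.inl h), ENNReal.mul_top (by simpa using hC₁)]
    · intro h
      refine hz ?_
      simp only
      rw [domKernel_eq_top (by linarith) (Or.inr (Or.inr (Or.inr h))),
        ENNReal.mul_top (by simpa using hC₁)]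
  · intro a b ha hab hb
    constructor
    · rw [lintegral_const_mul _ hm, mul_assoc, ENNReal.ofReal_mul hC₁.le]
      gcongr
      exact h2 a b ha hab hb
    · intro ε η hε hη
      filter_upwards [ae_mem_boxMeasure_prod a b T] with z hz
      exact h1 ε η z hε hη (hz.1.1.2.trans hb) (hz.2.1.2.trans hb) hz.1.2.1.le hz.2.2.1.le

theorem tendsto_momentKernel {H : ℝ} (h₀ : 0 < H) (h₁ : H < 1) {z : (ℝ × ℝ) × (ℝ × ℝ)}
    (hz1 : z.1.1 ≠ z.2.1) (hz2 : z.1.1 ≠ z.2.2) :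
    Tendsto (fun q : ℝ × ℝ ↦ momentKernel H q.1 q.2 z) (𝓝[>] 0 ×ˢ 𝓝[>] 0)
      (𝓝 (momentKernel H 0 0 z)) := by
  by_cases h1 : z.1.2 < z.1.1
  swap
  · simp [momentKernel, incrWeight, h1]
  by_cases h2 : z.2.2 < z.2.1
  swap
  · simp [momentKernel, incrWeight, h2]
  have hD := incrDet_add_pos h₀ h₁ h1.ne' hz1 hz2 h2.ne' le_rfl le_rfl
  have hle : (𝓝[>] (0 : ℝ) ×ˢ 𝓝[>] (0 : ℝ)) ≤ 𝓝 ((0 : ℝ), (0 : ℝ)) := by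
    rw [nhds_prod_eq]
    exact Filter.prod_mono nhdsWithin_le_nhds nhdsWithin_le_nhds
  refine Tendsto.mono_left ?_ hle
  have hc : ContinuousAt (fun q : ℝ × ℝ ↦ momentKernel H q.1 q.2 z) (0, 0) := by
    unfold momentKernel
    refine continuousAt_const.mul (continuousAt_const.div (continuousAt_const.mul
      (ContinuousAt.rpow_const (by fun_prop) (Or.inl hD.ne'))) ?_)
    have := Real.rpow_pos_of_pos hD (3 / 2)
    have := Real.pi_pos
    positivity
  exact hc

theorem tendsto_integral_momentKernel {H p T : ℝ} (h₀ : 0 < H) (h₁ : H < 2 / 3) (hp1 : p < 1)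
    (hp : 1 / 2 + 3 / 4 * H ≤ p) (hp' : 1 - H / 4 ≤ p) (hT : 1 ≤ T) {a b : ℝ} (ha : 0 ≤ a)
    (hab : a ≤ b) (hb : b ≤ T) :
    Tendsto (fun q : ℝ × ℝ ↦ ∫ z, momentKernel H q.1 q.2 z
        ∂(boxMeasure a b T).prod (boxMeasure a b T)) (𝓝[>] 0 ×ˢ 𝓝[>] 0)
      (𝓝 (∫ z, momentKernel H 0 0 z ∂(boxMeasure a b T).prod (boxMeasure a b T))) := by
  obtain ⟨C, hC, M, hM, hMne, hdom⟩ := exists_dominating_momentKernel h₀ h₁ hp1 hp hp' hT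
  obtain ⟨hMi, hle⟩ := hdom a b ha hab hb
  have hMi' : ∫⁻ z, M z ∂(boxMeasure a b T).prod (boxMeasure a b T) ≠ ∞ :=
    (hMi.trans_lt ENNReal.ofReal_lt_top).ne
  have hfin := ae_lt_top hM hMi'
  have hpos : ∀ᶠ q : ℝ × ℝ in 𝓝[>] 0 ×ˢ 𝓝[>] 0, 0 < q.1 ∧ 0 < q.2 :=
    (eventually_mem_nhdsWithin (a := (0 : ℝ)) (s := Set.Ioi 0)).prod_mk eventually_mem_nhdsWithin
  refine tendsto_integral_filter_of_dominated_convergence (fun z ↦ (M z).toReal)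
    (.of_forall fun q ↦ (measurable_momentKernel H q.1 q.2).aestronglyMeasurable) ?_
    (integrable_toReal_of_lintegral_ne_top hM.aemeasurable hMi') ?_
  · filter_upwards [hpos] with q hq
    filter_upwards [hle q.1 q.2 hq.1.le hq.2.le, hfin] with z hz hz'
    rw [Real.norm_eq_abs]
    exact (ENNReal.ofReal_le_iff_le_toReal hz'.ne).1 hz
  · filter_upwards [hfin] with z hz
    exact tendsto_momentKernel h₀ (by linarith) (hMne z hz.ne).1 (hMne z hz.ne).2

section

variable {Ω : Type*} [MeasurableSpace Ω] {P : Measure Ω} [IsProbabilityMeasure P] {H : ℝ}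
  {B : ℝ≥0 → Ω → ℝ}

theorem memLp_integral_dsltIntegrand (hH : 0 < H) (hBm : ∀ t, Measurable (B t))
    (hBc : ∀ ω, Continuous fun t ↦ B t ω) {ε : ℝ} (hε : 0 < ε) {a b T : ℝ} (ha : 0 ≤ a)
    (hb : b ≤ T) : MemLp (fun ω ↦ ∫ z, dsltIntegrand H B ε ω z ∂boxMeasure a b T) 2 P := by
  obtain ⟨K, hK, hbd⟩ := exists_abs_deriv_gaussKernel_le hε
  have hm : StronglyMeasurable fun ω ↦ ∫ z, dsltIntegrand H B ε ω z ∂boxMeasure a b T :=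
    (measurable_dsltIntegrand hBm hBc ε).stronglyMeasurable.integral_prod_right'
  refine MemLp.of_bound hm.aestronglyMeasurable
    (∫ z, incrWeight H z * K ∂boxMeasure a b T) (ae_of_all _ fun ω ↦ ?_)
  refine norm_integral_le_of_norm_le ((integrable_incrWeight hH ha hb).mul_const K)
    (ae_of_all _ fun z ↦ ?_)
  rw [dsltIntegrand, Real.norm_eq_abs, abs_mul, abs_of_nonneg (incrWeight_nonneg H z)]
  exact mul_le_mul_of_nonneg_left (hbd _) (incrWeight_nonneg H z)

theorem dsltApprox_eq (hH : 0 < H) (hBm : ∀ t, Measurable (B t))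
    (hBc : ∀ ω, Continuous fun t ↦ B t ω) {ε : ℝ} (hε : 0 < ε) {t : ℝ≥0} {T : ℝ} (hT : t ≤ T) :
    dsltApprox H B 0 ε t = -fun ω ↦ ∫ z, dsltIntegrand H B ε ω z ∂boxMeasure 0 t T := by
  ext ω
  have := dsltApprox_sub_dsltApprox hH hBm hBc hε ω (zero_le (a := t)) hT
  simpa [dsltApprox_zero] using this

theorem memLp_dsltApprox (hH : 0 < H) (hBm : ∀ t, Measurable (B t))
    (hBc : ∀ ω, Continuous fun t ↦ B t ω) {ε : ℝ} (hε : 0 < ε) (t : ℝ≥0) :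
    MemLp (dsltApprox H B 0 ε t) 2 P := by
  rw [dsltApprox_eq hH hBm hBc hε le_rfl]
  exact (memLp_integral_dsltIntegrand hH hBm hBc hε le_rfl le_rfl).neg

theorem exists_eLpNorm_dsltApprox_sub_le (hB : IsFractionalBrownianMotion H B P) {p T : ℝ}
    (h₀ : 0 < H) (h₁ : H < 2 / 3) (hp1 : p < 1) (hp : 1 / 2 + 3 / 4 * H ≤ p)
    (hp' : 1 - H / 4 ≤ p) (hT : 1 ≤ T) (hBm : ∀ t, Measurable (B t))
    (hBc : ∀ ω, Continuous fun t ↦ B t ω) :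
    ∃ C : ℝ, 0 < C ∧ ∀ (ε : ℝ) (a b : ℝ≥0), 0 < ε → a ≤ b → b ≤ T →
      eLpNorm (dsltApprox H B 0 ε b - dsltApprox H B 0 ε a) 2 P ≤
        ENNReal.ofReal √(C * ((b : ℝ) - a) ^ (2 - p)) := by
  obtain ⟨C, hC, M, hM, hMne, hdom⟩ := exists_dominating_momentKernel h₀ h₁ hp1 hp hp' hT
  refine ⟨C, hC, fun ε a b hε hab hb ↦ ?_⟩
  have hab' : (a : ℝ) ≤ b := hab
  obtain ⟨hMi, hle⟩ := hdom a b a.coe_nonneg hab' hb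
  have e : dsltApprox H B 0 ε b - dsltApprox H B 0 ε a =
      -fun ω ↦ ∫ z, dsltIntegrand H B ε ω z ∂boxMeasure a b T := by
    ext ω
    exact dsltApprox_sub_dsltApprox h₀ hBm hBc hε ω hab hb
  rw [e, eLpNorm_neg, (memLp_integral_dsltIntegrand h₀ hBm hBc hε a.coe_nonneg
    hb).eLpNorm_two_eq_ofReal_sqrt]
  refine ENNReal.ofReal_le_ofReal (Real.sqrt_le_sqrt ?_)
  simp_rw [sq]
  rw [integral_mul_integral_dsltIntegrand hB h₀ hBm hBc hε hε a.coe_nonneg hb]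
  have hR : 0 ≤ C * ((b : ℝ) - a) ^ (2 - p) :=
    mul_nonneg hC.le (Real.rpow_nonneg (by linarith) _)
  calc _ ≤ ‖∫ z, momentKernel H ε ε z ∂(boxMeasure a b T).prod (boxMeasure a b T)‖ :=
        Real.le_norm_self _
    _ ≤ (∫⁻ z, ENNReal.ofReal ‖momentKernel H ε ε z‖
          ∂(boxMeasure a b T).prod (boxMeasure a b T)).toReal := norm_integral_le_lintegral_norm _
    _ ≤ C * ((b : ℝ) - a) ^ (2 - p) :=
        ENNReal.toReal_le_of_le_ofReal hR ((lintegral_mono_ae (hle ε ε hε.le hε.le)).trans hMi)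

theorem exists_tendsto_eLpNorm_dsltApprox_sub (hB : IsFractionalBrownianMotion H B P)
    (h₀ : 0 < H) (h₁ : H < 2 / 3) (hBm : ∀ t, Measurable (B t))
    (hBc : ∀ ω, Continuous fun t ↦ B t ω) (t : ℝ≥0) :
    ∃ α : Ω → ℝ, MemLp α 2 P ∧
      Tendsto (fun ε : ℝ ↦ eLpNorm (dsltApprox H B 0 ε t - α) 2 P) (𝓝[>] 0) (𝓝 0) := by
  obtain ⟨p, hp1, hp, hp'⟩ : ∃ p : ℝ, p < 1 ∧ 1 / 2 + 3 / 4 * H ≤ p ∧ 1 - H / 4 ≤ p :=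
    ⟨max (1 / 2 + 3 / 4 * H) (1 - H / 4), max_lt (by linarith) (by linarith), le_max_left _ _,
      le_max_right _ _⟩
  -- The kernel estimates ask for T ≥ 1, so that log T ≥ 0 can absorb surplus powers.
  set T : ℝ := max 1 t with hT
  have hT1 : 1 ≤ T := le_max_left _ _
  have htT : t ≤ T := le_max_right _ _
  set J : ℝ → Ω → ℝ := fun ε ω ↦ ∫ z, dsltIntegrand H B ε ω z ∂boxMeasure 0 t T with hJ
  have hJm : ∀ ε, 0 < ε → MemLp (J ε) 2 P := fun ε hε ↦
    memLp_integral_dsltIntegrand h₀ hBm hBc hε le_rfl htT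
  set μ := (boxMeasure 0 t T).prod (boxMeasure 0 t T)
  have hlim := tendsto_integral_momentKernel h₀ h₁ hp1 hp hp' hT1 le_rfl t.coe_nonneg htT
  set L := ∫ z, momentKernel H 0 0 z ∂μ
  have hnorm : ∀ ε η, 0 < ε → 0 < η → eLpNorm (J ε - J η) 2 P = ENNReal.ofReal
      √(∫ z, momentKernel H ε ε z ∂μ - 2 * ∫ z, momentKernel H ε η z ∂μ +
        ∫ z, momentKernel H η η z ∂μ) := by
    intro ε η hε hη
    rw [((hJm ε hε).sub (hJm η hη)).eLpNorm_two_eq_ofReal_sqrt,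
      ← integral_mul_integral_dsltIntegrand hB h₀ hBm hBc hε hε le_rfl htT,
      ← integral_mul_integral_dsltIntegrand hB h₀ hBm hBc hε hη le_rfl htT,
      ← integral_mul_integral_dsltIntegrand hB h₀ hBm hBc hη hη le_rfl htT,
      ← integral_const_mul, ← integral_sub, ← integral_add]
    · congr 3
      ext ω
      simp only [Pi.sub_apply, hJ]
      ring
    · exact ((hJm ε hε).integrable_mul (hJm ε hε)).sub
        (((hJm ε hε).integrable_mul (hJm η hη)).const_mul 2)
    · exact (hJm η hη).integrable_mul (hJm η hη)
    · exact (hJm ε hε).integrable_mul (hJm ε hε)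
    · exact ((hJm ε hε).integrable_mul (hJm η hη)).const_mul 2
  have hcauchy := tendsto_zero_of_eq_ofReal_sqrt (f := fun ε η ↦ eLpNorm (J ε - J η) 2 P)
    (Φ := fun ε η ↦ ∫ z, momentKernel H ε η z ∂μ) hlim hnorm
  obtain ⟨f, hf, hfl⟩ := exists_tendsto_eLpNorm_sub_of_cauchy hJm hcauchy
  refine ⟨-f, hf.neg, hfl.congr' ?_⟩
  filter_upwards [eventually_mem_nhdsWithin (a := (0 : ℝ)) (s := Set.Ioi 0)] with ε hε
  rw [dsltApprox_eq h₀ hBm hBc hε htT, neg_sub_neg, ← neg_sub, eLpNorm_neg]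

/-- The increment bound is uniform in ε, so it survives the limit by the triangle inequality. -/
theorem exists_eLpNorm_limit_sub_le (hB : IsFractionalBrownianMotion H B P) {p T : ℝ}
    (h₀ : 0 < H) (h₁ : H < 2 / 3) (hp1 : p < 1) (hp : 1 / 2 + 3 / 4 * H ≤ p)
    (hp' : 1 - H / 4 ≤ p) (hT : 1 ≤ T) (hBm : ∀ t, Measurable (B t))
    (hBc : ∀ ω, Continuous fun t ↦ B t ω) {α : ℝ≥0 → Ω → ℝ} (hα : ∀ t, MemLp (α t) 2 P)
    (hlim : ∀ t, Tendsto (fun ε : ℝ ↦ eLpNorm (dsltApprox H B 0 ε t - α t) 2 P) (𝓝[>] 0) (𝓝 0)) :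
    ∃ C : ℝ, 0 < C ∧ ∀ a b : ℝ≥0, a ≤ b → b ≤ T →
      eLpNorm (α b - α a) 2 P ≤ ENNReal.ofReal √(C * ((b : ℝ) - a) ^ (2 - p)) := by
  obtain ⟨C, hC, h⟩ := exists_eLpNorm_dsltApprox_sub_le hB h₀ h₁ hp1 hp hp' hT hBm hBc
  refine ⟨C, hC, fun a b hab hb ↦ ?_⟩
  have hl := ((hlim b).add (hlim a)).add_const (ENNReal.ofReal √(C * ((b : ℝ) - a) ^ (2 - p)))
  rw [zero_add, zero_add] at hl
  refine ge_of_tendsto hl ?_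
  filter_upwards [eventually_mem_nhdsWithin (a := (0 : ℝ)) (s := Set.Ioi 0)] with ε hε
  have hmb := memLp_dsltApprox (P := P) h₀ hBm hBc hε b
  have hma := memLp_dsltApprox (P := P) h₀ hBm hBc hε a
  have e : α b - α a = -(dsltApprox H B 0 ε b - α b) + (dsltApprox H B 0 ε a - α a) +
      (dsltApprox H B 0 ε b - dsltApprox H B 0 ε a) := by abel
  rw [e]
  refine (eLpNorm_add_le (((hmb.sub (hα b)).neg.add (hma.sub (hα a))).aestronglyMeasurable)
    (hmb.sub hma).aestronglyMeasurable (by norm_num)).trans ?_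
  refine add_le_add ((eLpNorm_add_le (hmb.sub (hα b)).neg.aestronglyMeasurable
    (hma.sub (hα a)).aestronglyMeasurable (by norm_num)).trans ?_) (h ε a b hε hab hb)
  rw [eLpNorm_neg]

end

/-! ### Dyadic chaining and the continuous modification -/

/-- The value of `x` at the largest dyadic point of level `n` below `t`. -/
noncomputable def dyadicStep (x : ℝ≥0 → ℝ) (n : ℕ) (t : ℝ≥0) : ℝ :=
  x ((⌊2 ^ n * t⌋₊ : ℝ≥0) / 2 ^ n)

theorem abs_dyadicStep_succ_sub_le {x : ℝ≥0 → ℝ} {N : ℕ} {b : ℕ → ℝ} (hb : ∀ n, 0 ≤ b n)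
    (h : ∀ n k : ℕ, k < N * 2 ^ n →
      |x (((k + 1 : ℕ) : ℝ≥0) / 2 ^ n) - x ((k : ℝ≥0) / 2 ^ n)| ≤ b n)
    (n : ℕ) {t : ℝ≥0} (ht : t < N) :
    dist (dyadicStep x n t) (dyadicStep x (n + 1) t) ≤ b (n + 1) := by
  set m := ⌊2 ^ n * t⌋₊ with hm
  have e0 : (2 : ℝ≥0) ^ (n + 1) * t = 2 * (2 ^ n * t) := by ring
  have h1 : (m : ℝ≥0) ≤ 2 ^ n * t := Nat.floor_le (zero_le (a := 2 ^ n * t))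
  have h2 : 2 ^ n * t < m + 1 := Nat.lt_floor_add_one _
  have hlow : 2 * m ≤ ⌊(2 : ℝ≥0) ^ (n + 1) * t⌋₊ := by
    refine Nat.le_floor ?_
    rw [e0]; push_cast; gcongr
  have hup : ⌊(2 : ℝ≥0) ^ (n + 1) * t⌋₊ < 2 * m + 2 := by
    rw [Nat.floor_lt (zero_le (a := 2 ^ (n + 1) * t)), e0]
    push_cast
    calc 2 * (2 ^ n * t) < 2 * (m + 1) := by gcongr
      _ = _ := by ring
  have e1 : ((2 * m : ℕ) : ℝ≥0) / 2 ^ (n + 1) = (m : ℝ≥0) / 2 ^ n := by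
    push_cast; rw [pow_succ]; field_simp
  unfold dyadicStep
  rcases (by omega : ⌊(2 : ℝ≥0) ^ (n + 1) * t⌋₊ = 2 * m ∨ ⌊(2 : ℝ≥0) ^ (n + 1) * t⌋₊ = 2 * m + 1)
    with h3 | h3
  · rw [h3, e1, ← hm, dist_self]; exact hb _
  · rw [h3, ← hm, dist_comm, Real.dist_eq, ← e1]
    refine h (n + 1) (2 * m) ?_
    have : (m : ℝ≥0) < N * 2 ^ n := by
      calc (m : ℝ≥0) ≤ 2 ^ n * t := h1
        _ < 2 ^ n * N := by gcongr
        _ = _ := mul_comm _ _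
    have : m < N * 2 ^ n := by exact_mod_cast this
    rw [pow_succ, ← mul_assoc]; omega

theorem abs_dyadicStep_sub_le {x : ℝ≥0 → ℝ} {N : ℕ} {b : ℕ → ℝ} (hb : ∀ n, 0 ≤ b n)
    (h : ∀ n k : ℕ, k < N * 2 ^ n →
      |x (((k + 1 : ℕ) : ℝ≥0) / 2 ^ n) - x ((k : ℝ≥0) / 2 ^ n)| ≤ b n)
    (n : ℕ) {t t' : ℝ≥0} (ht' : t' < N) (htt : t ≤ t') (hd : t' ≤ t + 1 / 2 ^ n) :
    dist (dyadicStep x n t) (dyadicStep x n t') ≤ b n := by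
  set m := ⌊2 ^ n * t⌋₊ with hm
  have h1 : (m : ℝ≥0) ≤ 2 ^ n * t := Nat.floor_le (zero_le (a := 2 ^ n * t))
  have hlow : m ≤ ⌊2 ^ n * t'⌋₊ := Nat.floor_mono (by gcongr)
  have hup : ⌊2 ^ n * t'⌋₊ ≤ m + 1 := by
    rw [hm, ← Nat.floor_add_one (zero_le (a := 2 ^ n * t))]
    refine Nat.floor_mono ?_
    calc 2 ^ n * t' ≤ 2 ^ n * (t + 1 / 2 ^ n) := by gcongr
      _ = 2 ^ n * t + 1 := by field_simp
  unfold dyadicStep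
  rcases (by omega : ⌊2 ^ n * t'⌋₊ = m ∨ ⌊2 ^ n * t'⌋₊ = m + 1) with h3 | h3
  · rw [h3, ← hm, dist_self]; exact hb _
  · rw [h3, ← hm, dist_comm, Real.dist_eq]
    refine h n m ?_
    have : (m : ℝ≥0) < N * 2 ^ n := by
      calc (m : ℝ≥0) ≤ 2 ^ n * t := h1
        _ ≤ 2 ^ n * t' := by gcongr
        _ < 2 ^ n * N := by gcongr
        _ = _ := mul_comm _ _
    exact_mod_cast this

/-- Summable bounds make the steps Cauchy, locally uniformly in t. At one level, points within
2^{-n} have values differing by at most b n, so the limit is continuous although the steps are not.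
-/
theorem exists_continuous_tendsto_dyadicStep {x : ℝ≥0 → ℝ}
    (hx : ∀ N : ℕ, ∃ b : ℕ → ℝ, Summable b ∧ (∀ n, 0 ≤ b n) ∧ ∀ n k : ℕ, k < N * 2 ^ n →
      |x (((k + 1 : ℕ) : ℝ≥0) / 2 ^ n) - x ((k : ℝ≥0) / 2 ^ n)| ≤ b n) :
    ∃ y : ℝ≥0 → ℝ, Continuous y ∧ ∀ t, Tendsto (fun n ↦ dyadicStep x n t) atTop (𝓝 (y t)) := by
  have hlim : ∀ t, ∃ y, Tendsto (fun n ↦ dyadicStep x n t) atTop (𝓝 y) := by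
    intro t
    obtain ⟨N, hN⟩ := exists_nat_gt t
    obtain ⟨b, hbs, hb0, hb⟩ := hx N
    exact cauchySeq_tendsto_of_complete (cauchySeq_of_dist_le_of_summable (fun n ↦ b (n + 1))
      (fun n ↦ abs_dyadicStep_succ_sub_le hb0 hb n hN) ((summable_nat_add_iff 1).2 hbs))
  choose y hy using hlim
  refine ⟨y, ?_, hy⟩
  rw [continuous_iff_continuousAt]
  intro t₀
  obtain ⟨N, hN⟩ := exists_nat_gt t₀
  obtain ⟨b, hbs, hb0, hb⟩ := hx N
  have hsum : Summable fun n ↦ b (n + 1) := (summable_nat_add_iff 1).2 hbs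
  have hdist : ∀ (n : ℕ) (t : ℝ≥0), t < N →
      dist (dyadicStep x n t) (y t) ≤ ∑' m, b (n + m + 1) := fun n t ht ↦
    dist_le_tsum_of_dist_le_of_tendsto (fun n ↦ b (n + 1))
      (fun n ↦ abs_dyadicStep_succ_sub_le hb0 hb n ht) hsum (hy t) n
  have htail : Tendsto (fun n ↦ 2 * ∑' m, b (n + m + 1) + b n) atTop (𝓝 0) := by
    have h1 := tendsto_sum_nat_add fun n ↦ b (n + 1)
    have h2 := (h1.const_mul 2).add hbs.tendsto_atTop_zero
    rw [mul_zero, zero_add] at h2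
    refine h2.congr fun n ↦ ?_
    simp only [add_comm n]
  rw [Metric.continuousAt_iff']
  intro ε hε
  obtain ⟨n, hn⟩ := (htail.eventually (gt_mem_nhds hε)).exists
  have hpos : (0 : ℝ) < 1 / 2 ^ n := by positivity
  filter_upwards [Metric.ball_mem_nhds t₀ hpos, Iio_mem_nhds hN] with t ht htN
  have hd : dist (dyadicStep x n t) (dyadicStep x n t₀) ≤ b n := by
    rw [Metric.mem_ball, NNReal.dist_eq, abs_lt] at ht
    rcases le_total t t₀ with hle | hle
    · refine abs_dyadicStep_sub_le hb0 hb n hN hle ?_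
      rw [← NNReal.coe_le_coe]; push_cast; linarith
    · rw [dist_comm]
      refine abs_dyadicStep_sub_le hb0 hb n htN hle ?_
      rw [← NNReal.coe_le_coe]; push_cast; linarith
  have h1 := hdist n t htN
  have h2 := hdist n t₀ hN
  have h3 := dist_triangle4 (y t) (dyadicStep x n t) (dyadicStep x n t₀) (y t₀)
  rw [dist_comm (y t) (dyadicStep x n t)] at h3
  linarith

section

variable {Ω : Type*} [MeasurableSpace Ω] {P : Measure Ω}

theorem lintegral_enorm_sq_eq_eLpNorm_sq (f : Ω → ℝ) :
    ∫⁻ ω, ‖f ω‖ₑ ^ 2 ∂P = eLpNorm f 2 P ^ 2 := by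
  have := eLpNorm_nnreal_pow_eq_lintegral (f := f) (μ := P) (p := 2) (by norm_num)
  simpa using this.symm

theorem ae_exists_summable_dyadic_bound {X : ℝ≥0 → Ω → ℝ} (hX : ∀ t, AEStronglyMeasurable (X t) P)
    {q C : ℝ} (hq : 1 < q) (hC : 0 < C) {N : ℕ} (h : ∀ a b : ℝ≥0, a ≤ b → b ≤ N →
      eLpNorm (X b - X a) 2 P ≤ ENNReal.ofReal √(C * ((b : ℝ) - a) ^ q)) :
    ∀ᵐ ω ∂P, ∃ b : ℕ → ℝ, Summable b ∧ (∀ n, 0 ≤ b n) ∧ ∀ n k : ℕ, k < N * 2 ^ n →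
      |X (((k + 1 : ℕ) : ℝ≥0) / 2 ^ n) ω - X ((k : ℝ≥0) / 2 ^ n) ω| ≤ b n := by
  -- Level n has N·2^n increments with second moment at most C·2^{-nq}; since 2^{1-q} = c^{-2},
  -- weighting their squares by c^n leaves total expectation at most N C c^{-n}, still summable.
  set c : ℝ := 2 ^ ((q - 1) / 2) with hc
  have hc1 : 1 < c := Real.one_lt_rpow (by norm_num) (by linarith)
  have hc0 : 0 < c := by linarith
  set D : ℕ → ℕ → Ω → ℝ := fun n k ω ↦
    X (((k + 1 : ℕ) : ℝ≥0) / 2 ^ n) ω - X ((k : ℝ≥0) / 2 ^ n) ω with hD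
  have hDm : ∀ n k, AEStronglyMeasurable (D n k) P := fun n k ↦ (hX _).sub (hX _)
  have hDi : ∀ n k, k < N * 2 ^ n → ∫⁻ ω, ‖D n k ω‖ₑ ^ 2 ∂P ≤
      ENNReal.ofReal (C * ((1 / 2 ^ n : ℝ)) ^ q) := by
    intro n k hk
    have h1 := h ((k : ℝ≥0) / 2 ^ n) (((k + 1 : ℕ) : ℝ≥0) / 2 ^ n) (by gcongr; omega) (by
      rw [div_le_iff₀ (by positivity)]; exact_mod_cast hk)
    have e : (((((k + 1 : ℕ) : ℝ≥0) / 2 ^ n : ℝ≥0) : ℝ) - (((k : ℝ≥0) / 2 ^ n : ℝ≥0) : ℝ)) =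
        1 / 2 ^ n := by push_cast; ring
    rw [e] at h1
    rw [lintegral_enorm_sq_eq_eLpNorm_sq]
    calc eLpNorm (D n k) 2 P ^ 2 ≤ ENNReal.ofReal √(C * (1 / 2 ^ n) ^ q) ^ 2 := by
          gcongr; exact h1
      _ = _ := by
          rw [← ENNReal.ofReal_pow (Real.sqrt_nonneg _), Real.sq_sqrt (by positivity)]
  set A : ℕ → Ω → ℝ≥0∞ := fun n ω ↦
    ∑ k ∈ Finset.range (N * 2 ^ n), ENNReal.ofReal (c ^ n) * ‖D n k ω‖ₑ ^ 2 with hA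
  have hAm : ∀ n, AEMeasurable (A n) P := fun n ↦
    Finset.aemeasurable_fun_sum _ fun k _ ↦ ((hDm n k).enorm.pow_const 2).const_mul _
  have hAi : ∀ n, ∫⁻ ω, A n ω ∂P ≤ ENNReal.ofReal (N * C * (1 / c) ^ n) := by
    intro n
    rw [lintegral_finsetSum' _ fun k _ ↦ ((hDm n k).enorm.pow_const 2).const_mul _]
    calc _ ≤ ∑ k ∈ Finset.range (N * 2 ^ n),
          ENNReal.ofReal (c ^ n * (C * ((1 / 2 ^ n : ℝ)) ^ q)) := by
          refine Finset.sum_le_sum fun k hk ↦ ?_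
          rw [lintegral_const_mul' _ _ ENNReal.ofReal_ne_top, ENNReal.ofReal_mul (by positivity)]
          gcongr
          exact hDi n k (Finset.mem_range.1 hk)
      _ = _ := by
          rw [Finset.sum_const, Finset.card_range, nsmul_eq_mul, ← ENNReal.ofReal_natCast,
            ← ENNReal.ofReal_mul (by positivity)]
          congr 1
          have e1 : ((1 / 2 ^ n : ℝ)) ^ q = (1 / 2 ^ n) * ((1 / c) ^ n) ^ 2 := by
            have h2 : c ^ 2 = 2 ^ (q - 1) := by
              rw [hc, ← Real.rpow_natCast, ← Real.rpow_mul (by norm_num)]; congr 1; push_cast; ring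
            have h3 : (2 : ℝ) ^ q = 2 * c ^ 2 := by
              rw [h2, ← Real.rpow_one_add' (by norm_num) (by linarith)]; congr 1; ring
            rw [← pow_mul, mul_comm n 2, pow_mul, div_pow 1 c, h2, ← one_div_pow,
              ← Real.rpow_natCast (1 / 2 : ℝ) n, ← Real.rpow_mul (by norm_num), mul_comm (n : ℝ),
              Real.rpow_mul (by norm_num), Real.rpow_natCast, Real.rpow_natCast, ← mul_pow]
            congr 1
            rw [Real.div_rpow (by norm_num) (by norm_num), Real.one_rpow, h3, h2]
            field_simp
          rw [e1, one_div_pow c]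
          field_simp
          push_cast
          ring
  have hfin : ∫⁻ ω, ∑' n, A n ω ∂P ≠ ∞ := by
    rw [lintegral_tsum hAm]
    have hs : Summable fun n : ℕ ↦ N * C * (1 / c) ^ n :=
      (summable_geometric_of_lt_one (by positivity) ((div_lt_one hc0).2 hc1)).mul_left _
    refine ((ENNReal.tsum_le_tsum hAi).trans_lt ?_).ne
    rw [← ENNReal.ofReal_tsum_of_nonneg (fun n ↦ by positivity) hs]
    exact ENNReal.ofReal_lt_top
  filter_upwards [ae_lt_top' (AEMeasurable.tsum hAm) hfin] with ω hω
  -- The bound rests on d ≤ c^n d² + c^{-n}, which avoids square roots of the summable quantities.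
  refine ⟨fun n ↦ (A n ω).toReal + (1 / c) ^ n, (ENNReal.summable_toReal hω.ne).add
    (summable_geometric_of_lt_one (by positivity) ((div_lt_one hc0).2 hc1)),
    fun n ↦ by positivity, fun n k hk ↦ ?_⟩
  have hAn : A n ω ≠ ∞ := ENNReal.ne_top_of_tsum_ne_top hω.ne n
  have h1 : c ^ n * (D n k ω) ^ 2 ≤ (A n ω).toReal := by
    rw [← ENNReal.ofReal_le_iff_le_toReal hAn]
    have h2 : ENNReal.ofReal (c ^ n * (D n k ω) ^ 2) =
        ENNReal.ofReal (c ^ n) * ‖D n k ω‖ₑ ^ 2 := by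
      rw [ENNReal.ofReal_mul (by positivity), ← sq_abs (D n k ω), ENNReal.ofReal_pow (abs_nonneg _),
        Real.enorm_eq_ofReal_abs]
    rw [h2]
    exact Finset.single_le_sum (f := fun k ↦ ENNReal.ofReal (c ^ n) * ‖D n k ω‖ₑ ^ 2)
      (fun _ _ ↦ zero_le) (Finset.mem_range.2 hk)
  refine le_trans ?_ (add_le_add_left h1 _)
  have hcn : 0 < c ^ n := by positivity
  change |D n k ω| ≤ _
  rw [one_div_pow, ← sq_abs]
  set d := |D n k ω|
  have : (c ^ n * d ^ 2 + 1 / c ^ n - d) * c ^ n = (c ^ n * d) ^ 2 - c ^ n * d + 1 := by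
    field_simp
    ring
  by_contra hcon
  push Not at hcon
  nlinarith [mul_pos hcn (sub_pos.2 hcon), sq_nonneg (c ^ n * d - 1 / 2)]

/-- The dyadic steps at t converge almost everywhere to the continuous limit and in L² to X t;
uniqueness of limits in measure identifies the two. -/
theorem exists_continuous_modification_of_eLpNorm_le [IsFiniteMeasure P] {X : ℝ≥0 → Ω → ℝ}
    (hX : ∀ t, AEStronglyMeasurable (X t) P) {q : ℝ} (hq : 1 < q)
    (h : ∀ N : ℕ, ∃ C : ℝ, 0 < C ∧ ∀ a b : ℝ≥0, a ≤ b → b ≤ N →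
      eLpNorm (X b - X a) 2 P ≤ ENNReal.ofReal √(C * ((b : ℝ) - a) ^ q)) :
    ∃ Y : ℝ≥0 → Ω → ℝ, (∀ ω, Continuous fun t ↦ Y t ω) ∧ ∀ t, Y t =ᵐ[P] X t := by
  have hae : ∀ᵐ ω ∂P, ∃ y : ℝ≥0 → ℝ, Continuous y ∧
      ∀ t, Tendsto (fun n ↦ dyadicStep (fun t ↦ X t ω) n t) atTop (𝓝 (y t)) := by
    have : ∀ᵐ ω ∂P, ∀ N : ℕ, ∃ b : ℕ → ℝ, Summable b ∧ (∀ n, 0 ≤ b n) ∧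
        ∀ n k : ℕ, k < N * 2 ^ n →
          |X (((k + 1 : ℕ) : ℝ≥0) / 2 ^ n) ω - X ((k : ℝ≥0) / 2 ^ n) ω| ≤ b n := by
      refine ae_all_iff.2 fun N ↦ ?_
      obtain ⟨C, hC, hN⟩ := h N
      exact ae_exists_summable_dyadic_bound hX hq hC hN
    filter_upwards [this] with ω hω using exists_continuous_tendsto_dyadicStep hω
  classical
  let Y : ℝ≥0 → Ω → ℝ := fun t ω ↦ if hω : ∃ y : ℝ≥0 → ℝ, Continuous y ∧
      ∀ t, Tendsto (fun n ↦ dyadicStep (fun t ↦ X t ω) n t) atTop (𝓝 (y t)) then hω.choose t else 0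
  refine ⟨Y, fun ω ↦ ?_, fun t ↦ ?_⟩
  · by_cases hω : ∃ y : ℝ≥0 → ℝ, Continuous y ∧
      ∀ t, Tendsto (fun n ↦ dyadicStep (fun t ↦ X t ω) n t) atTop (𝓝 (y t))
    · simp only [Y, dif_pos hω]
      exact hω.choose_spec.1
    · simp only [Y, dif_neg hω]
      exact continuous_const
  · set Z : ℕ → Ω → ℝ := fun n ω ↦ dyadicStep (fun t ↦ X t ω) n t with hZ
    have hZm : ∀ n, AEStronglyMeasurable (Z n) P := fun n ↦ hX _
    have hZY : TendstoInMeasure P Z atTop (Y t) := by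
      refine tendstoInMeasure_of_tendsto_ae hZm ?_
      filter_upwards [hae] with ω hω
      simp only [Y, dif_pos hω]
      exact hω.choose_spec.2 t
    have hZX : TendstoInMeasure P Z atTop (X t) := by
      refine tendstoInMeasure_of_tendsto_eLpNorm (p := 2) (by norm_num) hZm (hX t) ?_
      obtain ⟨N, hN⟩ := exists_nat_gt t
      obtain ⟨C, hC, hCN⟩ := h N
      have hlim : Tendsto (fun n : ℕ ↦ ENNReal.ofReal √(C * ((1 / 2 : ℝ) ^ n) ^ q))
          atTop (𝓝 0) := by
        have h1 : Tendsto (fun n : ℕ ↦ (1 / 2 : ℝ) ^ n) atTop (𝓝 0) :=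
          tendsto_pow_atTop_nhds_zero_of_lt_one (by norm_num) (by norm_num)
        have h2 := ((h1.rpow_const (p := q) (Or.inr (by linarith))).const_mul C).sqrt
        have h3 := ENNReal.tendsto_ofReal h2
        rwa [Real.zero_rpow (by linarith), mul_zero, Real.sqrt_zero, ENNReal.ofReal_zero] at h3
      refine tendsto_of_tendsto_of_tendsto_of_le_of_le tendsto_const_nhds hlim (fun _ ↦ zero_le)
        fun n ↦ ?_
      have h1 : (⌊2 ^ n * t⌋₊ : ℝ≥0) ≤ 2 ^ n * t := Nat.floor_le (zero_le (a := 2 ^ n * t))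
      have h2 : 2 ^ n * t < ⌊2 ^ n * t⌋₊ + 1 := Nat.lt_floor_add_one _
      have h3 : (⌊2 ^ n * t⌋₊ : ℝ≥0) / 2 ^ n ≤ t := by
        rw [div_le_iff₀ (by positivity), mul_comm t]; exact h1
      have h4 : (t : ℝ) - (((⌊2 ^ n * t⌋₊ : ℝ≥0) / 2 ^ n : ℝ≥0) : ℝ) ≤ (1 / 2) ^ n := by
        have h2' : (2 : ℝ) ^ n * t < ⌊2 ^ n * t⌋₊ + 1 := by exact_mod_cast h2
        push_cast
        rw [one_div_pow, sub_le_iff_le_add, ← add_div, le_div_iff₀ (by positivity)]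
        linarith
      have h5 : (0 : ℝ) ≤ (t : ℝ) - (((⌊2 ^ n * t⌋₊ : ℝ≥0) / 2 ^ n : ℝ≥0) : ℝ) :=
        sub_nonneg.2 (by exact_mod_cast h3)
      rw [eLpNorm_sub_comm]
      refine (hCN _ t h3 hN.le).trans (ENNReal.ofReal_le_ofReal (Real.sqrt_le_sqrt ?_))
      gcongr
    exact tendstoInMeasure_ae_unique hZY hZX

end

/-! ### The main theorem -/

theorem mainTheorem5 {Ω : Type*} [MeasurableSpace Ω] (P : Measure Ω) [IsProbabilityMeasure P]
    (H : ℝ) (hH_pos : 0 < H) (hH_lt : H < 2 / 3)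
    (B : ℝ≥0 → Ω → ℝ) (hB : IsFractionalBrownianMotion H B P) :
    (∀ (t : ℝ≥0) (ε : ℝ), 0 < ε → MemLp (dsltApprox H B 0 ε t) 2 P) ∧
    ∃ α : ℝ≥0 → Ω → ℝ,
      (∀ t : ℝ≥0, MemLp (α t) 2 P) ∧
      (∀ t : ℝ≥0, Tendsto (fun ε : ℝ ↦ eLpNorm (dsltApprox H B 0 ε t - α t) 2 P)
        (𝓝[>] 0) (𝓝 0)) ∧
      (∀ ω : Ω, Continuous fun t : ℝ≥0 ↦ α t ω) ∧
      (∀ t₀ : ℝ≥0, Tendsto (fun t : ℝ≥0 ↦ eLpNorm (α t - α t₀) 2 P) (𝓝 t₀) (𝓝 0)) := by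
  obtain ⟨B', hB', hBm, hBc, hBB'⟩ := hB.exists_modification
  have hd : ∀ ε t, dsltApprox H B 0 ε t =ᵐ[P] dsltApprox H B' 0 ε t := fun ε t ↦
    hBB'.mono fun ω hω ↦ dsltApprox_congr hω 0 ε t
  refine ⟨fun t ε hε ↦ (memLp_congr_ae (hd ε t)).2 (memLp_dsltApprox hH_pos hBm hBc hε t), ?_⟩
  -- The limits are chosen separately for each t, so X has no path regularity; continuity enters
  -- only through its modification Y.
  choose X hX hXlim using
    fun t ↦ exists_tendsto_eLpNorm_dsltApprox_sub hB' hH_pos hH_lt hBm hBc t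
  set p : ℝ := max (1 / 2 + 3 / 4 * H) (1 - H / 4) with hp
  have hp1 : p < 1 := max_lt (by linarith) (by linarith)
  have hbound : ∀ N : ℕ, ∃ C : ℝ, 0 < C ∧ ∀ a b : ℝ≥0, a ≤ b → b ≤ N →
      eLpNorm (X b - X a) 2 P ≤ ENNReal.ofReal √(C * ((b : ℝ) - a) ^ (2 - p)) := by
    intro N
    obtain ⟨C, hC, h⟩ := exists_eLpNorm_limit_sub_le hB' (T := max 1 N) hH_pos hH_lt hp1
      (le_max_left _ _) (le_max_right _ _) (le_max_left _ _) hBm hBc hX hXlim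
    exact ⟨C, hC, fun a b hab hb ↦ h a b hab (le_max_of_le_right (by exact_mod_cast hb))⟩
  obtain ⟨Y, hYc, hYX⟩ := exists_continuous_modification_of_eLpNorm_le
    (fun t ↦ (hX t).aestronglyMeasurable) (by linarith) hbound
  refine ⟨Y, fun t ↦ (memLp_congr_ae (hYX t)).2 (hX t), fun t ↦ ?_, hYc, fun t₀ ↦ ?_⟩
  · refine (hXlim t).congr fun ε ↦ ?_
    exact eLpNorm_congr_ae ((hd ε t).symm.sub (hYX t).symm)
  · obtain ⟨N, hN⟩ := exists_nat_gt t₀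
    obtain ⟨C, hC, h⟩ := hbound N
    have hlim : Tendsto (fun t : ℝ≥0 ↦ ENNReal.ofReal √(C * |(t : ℝ) - t₀| ^ (2 - p)))
        (𝓝 t₀) (𝓝 0) := by
      have h1 : Tendsto (fun t : ℝ≥0 ↦ |(t : ℝ) - t₀|) (𝓝 t₀) (𝓝 |(t₀ : ℝ) - t₀|) :=
        Continuous.tendsto (by fun_prop) t₀
      rw [sub_self, abs_zero] at h1
      have h2 := ((h1.rpow_const (p := 2 - p) (Or.inr (by linarith))).const_mul C).sqrt
      have h3 := ENNReal.tendsto_ofReal h2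
      rwa [Real.zero_rpow (by linarith), mul_zero, Real.sqrt_zero, ENNReal.ofReal_zero] at h3
    refine tendsto_of_tendsto_of_tendsto_of_le_of_le' tendsto_const_nhds hlim
      (Eventually.of_forall fun _ ↦ zero_le) ?_
    filter_upwards [Iio_mem_nhds hN] with t ht
    rw [eLpNorm_congr_ae ((hYX t).sub (hYX t₀))]
    rcases le_total t t₀ with hle | hle
    · rw [eLpNorm_sub_comm, abs_sub_comm, abs_of_nonneg (sub_nonneg.2 (by exact_mod_cast hle))]
      exact h t t₀ hle hN.le
    · rw [abs_of_nonneg (sub_nonneg.2 (by exact_mod_cast hle))]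
      exact h t₀ t hle (le_of_lt ht)
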